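/- **Setting.** An infinite-horizon adversarial MDP consists of finite sets $\mathcal S,\mathcal A$ with $S=|\mathcal S|\ge 2$, $A=|\mathcal A|\ge 1$, a transition function $\mathbb P:\mathcal S\times\mathcal A\to\triangle(\mathcal S)$, losses $\ell^1,\dots,\ell^T:\mathcal S\times\mathcal A\to[0,1]$ fixed in advance, a number $T\ge1$ of steps and an initial state $s^1$. In step $t$ the agent is in $s^t$, chooses $a^t$, suffers and observes only $\ell^t(s^t,a^t)$ (bandit feedback), and moves to $s^{t+1}\sim\mathbb P(\cdot\mid s^t,a^t)$; there are no resets. The agent knows $\mathbb P$ and $s^1$. Let $\Pi=\mathcal A^{\mathcal S}$ be the set of deterministic policies, let $\mu_\pi^t(s)$ and $\mu_\pi^t(s,a)=\mu^t_\pi(s)\mathbb 1[\pi(s)=a]$ be the distributions of the state and of the state-action pair in step $t$ when $\pi$ is followed from step $1$, and put $\langle\mu_\pi^t,f\rangle=\sum_{s,a}\mu_\pi^t(s,a)f(s,a)$. The regret of an algorithm is $$\mathcal R_T=\mathbb E\Big[\sum_{t=1}^T\ell^t(s^t,a^t)\Big]-\min_{\pi\in\Pi}\sum_{t=1}^T\langle\mu_\pi^t,\ell^t\rangle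 .$$ Let $T(s'\mid\pi,s)$ be the number of steps that $\pi$ needs to first reach $s'$ from $s$. Assume that the MDP is communicating, i.e. its diameter $D=\max_{s\ne s'}\min_{\pi\in\Pi}\mathbb E[T(s'\mid\pi,s)]$ is finite, and that there are $s^*\in\mathcal S$, $a^*\in\mathcal A$ with $\mathbb P(s^*\mid s^*,a^*)=1$. **Switching procedure.** It uses (i) for every $s\neq s^*$ a policy $\pi_{s,s^*}\in\Pi$ with $\mathbb E[T(s^*\mid\pi_{s,s^*},s)]\le D$; (ii) an integer $l^*\le 2D$ and for every $g\in\mathcal S$ a (possibly time-dependent) deterministic policy $\pi_g$ which, started in $s^*$, is in $g$ after exactly $l^*$ steps with a probability $p_g\ge\frac1{4D}$. Let $p^*=\min_g p_g$. To switch to $\pi\in\Pi$, repeat: from the current state $s$ move to $s^*$ by $\pi_{s,s^*}$ (no step if $s=s^*$); if $s^*$ is reached at the beginning of step $t$, draw $g\sim\mu_\pi^{t+l^*}$ and follow $\pi_g$ for $l^*$ steps; if the state is then $g$, return with probability $p^*/p_g$; if the procedure does not return, repeat. **Hedge algorithm** with parameters $\eta>0$ and $J\in\mathbb N$, $J\ge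 1$. Let $H=\lceil T/J\rceil$. Epoch $j=1,\dots,J$ has the steps $\mathcal T_j=\{(j-1)H+1,\dots,jH\}\cap[1,T]$. As soon as step $(j-1)H+1$ is reached and the switching procedure of the previous epoch, if any, has returned, draw $\pi_j\sim p_j$ where $p_j(\pi)\propto\exp\big(-\eta\sum_{t\le(j-1)H}\langle\mu_\pi^t,\hat\ell^t\rangle\big)$ on $\Pi$, and run the switching procedure for $\pi_j$. In each step $t\in\mathcal T_j$ that remains after it has returned, play $a^t=\pi_j(s^t)$ and set $$\hat\ell^t(s,a)=\mathbb 1[(s,a)=(s^t,a^t)]\,\frac{\ell^t(s^t,a^t)}{\sum_{\pi\in\Pi}p_j(\pi)\mu_\pi^t(s,a)} .$$ In all other steps $\hat\ell^t=0$. The algorithm stops after step $T$. **Theorem.** There are absolute constants $C$ and $k\in\mathbb N$ such that in this setting choices (i) and (ii) exist and, for every such choice, the Hedge algorithm with $$\eta=\frac{S^{1/3}}{A^{1/3}(DT)^{2/3}},\qquad J=\Big\lceil\frac{(ST)^{2/3}A^{1/3}}{D^{4/3}}\Big\rceil$$ satisfies $$\mathcal R_T\le C\,\big(\ln(SAT)\big)^k\,A^{1/3}(SDT)^{2/3},$$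 that is, $\mathcal R_T=\tilde{O}\big(A^{1/3}(SDT)^{2/3}\big)$. -/

import Mathlib

open scoped ENNReal

noncomputable section

/-- An infinite-horizon adversarial Markov decision process: a time-independent transition
function, an oblivious sequence of losses in `[0, 1]`, the number `T` of steps and the initial
state. Time slots are counted from `0`, so the steps are the slots `t < T`. -/
structure AMDP (S A : Type*) where
  trans : S → A → PMF S
  loss : ℕ → S → A → ℝ
  loss_nonneg : ∀ t s a, 0 ≤ loss t s a
  loss_le_one : ∀ t s a, loss t s a ≤ 1
  horizon : ℕ
  init : S

/-- Deterministic (stationary) policies. -/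
abbrev Policy (S A : Type*) := S → A

/-- Expectation of a real random variable under a discrete distribution. -/
def PMF.expect {α : Type*} (p : PMF α) (f : α → ℝ) : ℝ := ∑' x, (p x).toReal * f x

namespace AMDP

section Basic

variable {S A : Type*} (M : AMDP S A)

/-- Law of the state after `n` steps from `s`, when the policy `σ i` is used in the `i`-th step. -/
def lawAfter (σ : ℕ → Policy S A) (s : S) : ℕ → PMF S
  | 0 => PMF.pure s
  | n + 1 => (lawAfter σ s n).bind fun u => M.trans u (σ n u)

/-- `μ_π^t`: law of the state in slot `t` when `π` is followed from the very beginning. -/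
def stateLaw (π : Policy S A) (t : ℕ) : PMF S := M.lawAfter (fun _ => π) M.init t

variable [Fintype S] [DecidableEq S]

/-- The probability that the first visit to `g` (under `π`, started in `s`) takes place after
exactly `n` steps, i.e. `Pr{T(g | π, s) = n}`. -/
def firstHitProb (π : Policy S A) (g : S) : ℕ → S → ℝ≥0∞
  | 0, s => if s = g then 1 else 0
  | n + 1, s =>
      if s = g then 0 else ∑ u, M.trans s (π s) u * firstHitProb π g n u

/-- The expected number of steps `E[T(g | π, s)]` until `g` is first reached from `s`; the second
summand is the contribution of the event that `g` is never reached, on which the time is `∞`. -/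
def expHitTime (π : Policy S A) (g s : S) : ℝ≥0∞ :=
  (∑' n : ℕ, (n : ℝ≥0∞) * M.firstHitProb π g n s) +
    ∞ * (1 - ∑' n : ℕ, M.firstHitProb π g n s)

/-- The diameter. The AMDP is communicating when this is finite. -/
def diameter : ℝ≥0∞ :=
  ⨆ (s : S) (g : S) (_ : s ≠ g), ⨅ π : Policy S A, M.expHitTime π g s

/-- The policies and the length `l*` used by the policy switching procedure with parking state
`sStar`: from every other state a policy that reaches `sStar` within `D` expected steps, and for
every target state `g` a (time-dependent) policy which, started in `sStar`, is in `g` after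
exactly `l* ≤ 2D` steps with probability at least `1 / (4D)`. -/
structure SwitchPlan (sStar : S) where
  toStar : S → Policy S A
  toStar_spec : ∀ s, s ≠ sStar → M.expHitTime (toStar s) sStar s ≤ M.diameter
  len : ℕ
  len_le : (len : ℝ≥0∞) ≤ 2 * M.diameter
  aim : S → ℕ → Policy S A
  aim_spec : ∀ g, (4 * M.diameter)⁻¹ ≤ M.lawAfter (aim g) sStar len g

/-- `p_g`: the probability of being in `g` after `l*` steps of the policy that aims at `g`. -/
def SwitchPlan.succProb {M : AMDP S A} {sStar : S} (W : M.SwitchPlan sStar) (g : S) : ℝ≥0∞ :=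
  M.lawAfter (W.aim g) sStar W.len g

/-- The acceptance probability `p* / p_g`, where `p* = min_s p_s`. -/
def SwitchPlan.acceptProb {M : AMDP S A} {sStar : S} (W : M.SwitchPlan sStar) (g : S) : ℝ≥0∞ :=
  (⨅ s, W.succProb s) / W.succProb g

theorem SwitchPlan.acceptProb_le_one {M : AMDP S A} {sStar : S} (W : M.SwitchPlan sStar) (g : S) :
    W.acceptProb g ≤ 1 :=
  ENNReal.div_le_of_le_mul (by simpa using iInf_le W.succProb g)

/-- A coin which shows `true` with probability `p* / p_g`. -/
def SwitchPlan.coin {M : AMDP S A} {sStar : S} (W : M.SwitchPlan sStar) (g : S) : PMF Bool :=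
  PMF.ofFintype (fun b => if b then W.acceptProb g else 1 - W.acceptProb g) (by
    simpa using add_tsub_cancel_of_le (W.acceptProb_le_one g))

end Basic

/-- What the agent is currently doing: playing the policy of the epoch, moving to the parking
state with the policy chosen for the state `origin`, or aiming at `target`, with `steps` steps of
the attempt already made. -/
inductive Phase (S : Type*) where
  | play
  | moving (origin : S)
  | aiming (target : S) (steps : ℕ)

/-- Configuration of agent and environment: the current state, the number of epochs begun so far,
the policy of the current epoch, the current phase, the loss estimators `ℓ̂^t(s, a)` computed so
far (zero where none was computed) and the total loss suffered so far. -/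
structure Config (S A : Type*) where
  state : S
  begun : ℕ
  policy : Policy S A
  phase : Phase S
  est : ℕ → S → A → ℝ
  total : ℝ

section Hedge

variable {S A : Type*} [Fintype S] [DecidableEq S] [Fintype A] [DecidableEq A]
  (M : AMDP S A)

/-- `μ_π^t(s, a)`: probability of the state-action pair in slot `t` under `π`. -/
def occupancy (π : Policy S A) (t : ℕ) (s : S) (a : A) : ℝ :=
  if π s = a then (M.stateLaw π t s).toReal else 0

/-- The weight of `π` in the Hedge distribution that uses the estimators of the slots `t < n`. -/
def hedgeWeight (η : ℝ) (est : ℕ → S → A → ℝ) (n : ℕ) (π : Policy S A) : ℝ :=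
  Real.exp (-η * ∑ t ∈ Finset.range n, ∑ s, ∑ a, M.occupancy π t s a * est t s a)

variable [Nonempty A]

/-- The Hedge distribution over all deterministic policies. -/
def hedge (η : ℝ) (est : ℕ → S → A → ℝ) (n : ℕ) : PMF (Policy S A) :=
  PMF.ofFintype
    (fun π => ENNReal.ofReal
      (M.hedgeWeight η est n π / ∑ π' : Policy S A, M.hedgeWeight η est n π')) (by
    have hpos : ∀ π : Policy S A, 0 < M.hedgeWeight η est n π := fun π => Real.exp_pos _
    have hsum : 0 < ∑ π' : Policy S A, M.hedgeWeight η est n π' :=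
      Finset.sum_pos (fun π _ => hpos π) Finset.univ_nonempty
    rw [← ENNReal.ofReal_sum_of_nonneg fun π _ => (div_pos (hpos π) hsum).le,
      ← Finset.sum_div, div_self hsum.ne', ENNReal.ofReal_one])

variable {M} {sStar : S} (W : M.SwitchPlan sStar)

/-- If an attempt has made its `l*` steps, it succeeds when the target was hit and the coin shows
`true` (then the switching procedure returns); otherwise its loop is repeated. -/
def finishAttempt (c : Config S A) : PMF (Config S A) :=
  match c.phase with
  | .aiming g n =>
      if n = W.len then
        if c.state = g then
          (W.coin g).map fun b => { c with phase := if b then .play else .moving c.state }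
        else PMF.pure { c with phase := .moving c.state }
      else PMF.pure c
  | _ => PMF.pure c

/-- If no switching procedure is running and the next epoch (epoch number `c.begun`, counted from
`0`, with the slots from `c.begun * H` on) is due, draw its policy from the Hedge distribution
and start the switching procedure. -/
def beginEpoch (η : ℝ) (H t : ℕ) (c : Config S A) : PMF (Config S A) :=
  match c.phase with
  | .play =>
      if c.begun * H ≤ t then
        (M.hedge η c.est (c.begun * H)).map fun π =>
          { c with begun := c.begun + 1, policy := π, phase := .moving c.state }
      else PMF.pure c
  | _ => PMF.pure c

/-- If the switching procedure has arrived at the parking state, draw a target from the state law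
that the new policy would have at the end of the attempt, and start an attempt. -/
def beginAttempt (t : ℕ) (c : Config S A) : PMF (Config S A) :=
  match c.phase with
  | .moving _ =>
      if c.state = sStar then
        (M.stateLaw c.policy (t + W.len)).map fun g => { c with phase := .aiming g 0 }
      else PMF.pure c
  | _ => PMF.pure c

/-- The action taken in a configuration. -/
def action (c : Config S A) : A :=
  match c.phase with
  | .play => c.policy c.state
  | .moving o => W.toStar o c.state
  | .aiming g n => W.aim g n c.state

/-- The importance weighted estimator for slot `t` after observing the loss `x` of the pair
`(s₀, a₀)`, when the policy was drawn from `p`. -/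
def lossEstimate (p : PMF (Policy S A)) (t : ℕ) (s₀ : S) (a₀ : A) (x : ℝ) (s : S) (a : A) : ℝ :=
  if s = s₀ ∧ a = a₀ then
    x / ∑ π : Policy S A, (p π).toReal * M.occupancy π t s a
  else 0

/-- Estimators after slot `t`: an estimator is computed only in the slots in which the policy of
the epoch is played. -/
def nextEst (η : ℝ) (H t : ℕ) (c : Config S A) : ℕ → S → A → ℝ :=
  match c.phase with
  | .play =>
      Function.update c.est t
        (lossEstimate (M := M) (M.hedge η c.est ((c.begun - 1) * H)) t c.state
          (c.policy c.state) (M.loss t c.state (c.policy c.state)))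
  | _ => c.est

def nextPhase : Phase S → Phase S
  | .aiming g n => .aiming g (n + 1)
  | φ => φ

/-- One slot: the pending random choices of the agent are made, an action is taken, its loss is
suffered and observed, and the environment moves to the next state. -/
def slot (η : ℝ) (H t : ℕ) (c₀ : Config S A) : PMF (Config S A) :=
  (finishAttempt W c₀).bind fun c₁ =>
  (beginEpoch (M := M) η H t c₁).bind fun c₂ =>
  (beginAttempt W t c₂).bind fun c =>
  (M.trans c.state (action W c)).map fun s' =>
    { state := s'
      begun := c.begun
      policy := c.policy
      phase := nextPhase c.phase
      est := nextEst (M := M) η H t c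
      total := c.total + M.loss t c.state (action W c) }

/-- The configuration before slot `0`. No epoch has begun, and the policy entered here is
replaced before it is used. -/
def initConfig : Config S A where
  state := M.init
  begun := 0
  policy := W.toStar M.init
  phase := .play
  est := fun _ _ _ => 0
  total := 0

/-- Law of the configuration after the first `n` slots, for learning rate `η` and epoch
length `H`. -/
def run (η : ℝ) (H : ℕ) : ℕ → PMF (Config S A)
  | 0 => PMF.pure (initConfig W)
  | n + 1 => (run η H n).bind (slot W η H n)

/-- Length `⌈T / J⌉` of an epoch when the `T` slots are divided into `J` epochs. -/
def epochLength (T J : ℕ) : ℕ := ⌈(T : ℝ) / J⌉₊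

variable (M) in
/-- Expected total loss of a fixed policy that is followed from the very beginning. -/
def policyLoss (π : Policy S A) : ℝ :=
  ∑ t ∈ Finset.range M.horizon, ∑ s, (M.stateLaw π t s).toReal * M.loss t s (π s)

/-- The regret of the Hedge algorithm with learning rate `η` and `J` epochs. -/
def hedgeRegret (η : ℝ) (J : ℕ) : ℝ :=
  (run W η (epochLength M.horizon J) M.horizon).expect Config.total -
    ⨅ π : Policy S A, M.policyLoss π

end Hedge

end AMDP

end

/-! Rejection makes every attempt of the switching procedure succeed at its target `g` with
probability `p_g * (p* / p_g) = p*`, whatever `g` is. As `g` is drawn from the state law of the new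
policy at the end of the attempt, the state on return has exactly the law it would have had if that
policy had been followed from the start. Two consequences carry the proof.

Cost: a loop lasts at most `D + l*` expected steps and ends the procedure with probability `p* ≥
1/(4D)`, so a switch takes at most `(D + l*)/p* ≤ 12 D^2` expected steps and all `J` switches at
most `12 J D^2` (`mean_switchLoss_le`).

Estimators: in a slot that is played, the estimator has the mean of ordinary importance weighting;
in the other slots it is zero. Hence its expected pairing with any fixed policy is at most the true
loss, and its expected second moment under the Hedge law is at most `S * A` (`mean_est_le`).

In a played slot the suffered loss equals the Hedge average of the estimated losses exactly. So the
total loss is the loss during switching plus a quantity controlled pathwise by the exponential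
weights bound with epochs as rounds (`sum_hedgeLoss_le`), where squaring an epoch costs a factor
`H`. With `A^S` policies this gives regret at most `12 J D^2 + S ln A / η + η H T S A`, and
`regret_tuning` balances the three terms.

Both expectations are bounded by nonnegative potentials on configurations whose mean does not
increase in a slot. Values in `ℝ≥0∞` make integrability and summability automatic. -/

noncomputable section

namespace AMDP

/-! ### Expectations with values in `[0, ∞]` -/

section Mean

variable {α β : Type*}

/-- Expectation of an `ℝ≥0∞`-valued function under a discrete distribution. -/
def mean (p : PMF α) (f : α → ℝ≥0∞) : ℝ≥0∞ := ∑' x, p x * f x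

theorem mean_pure (a : α) (f : α → ℝ≥0∞) : mean (PMF.pure a) f = f a := by
  classical
  rw [mean, tsum_eq_single a]
  · simp
  · intro b hb
    simp [PMF.pure_apply, hb]

theorem mean_bind (p : PMF α) (q : α → PMF β) (f : β → ℝ≥0∞) :
    mean (p.bind q) f = mean p fun x => mean (q x) f := by
  simp only [mean, PMF.bind_apply, ← ENNReal.tsum_mul_right, ← ENNReal.tsum_mul_left]
  rw [ENNReal.tsum_comm]
  simp only [mul_assoc]

theorem mean_map (p : PMF α) (g : α → β) (f : β → ℝ≥0∞) :
    mean (p.map g) f = mean p fun x => f (g x) := by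
  rw [PMF.map, mean_bind]
  simp [mean_pure]

theorem mean_mono_support {p : PMF α} {f g : α → ℝ≥0∞} (h : ∀ x ∈ p.support, f x ≤ g x) :
    mean p f ≤ mean p g := by
  refine ENNReal.tsum_le_tsum fun x => ?_
  by_cases hx : p x = 0
  · simp [hx]
  · exact mul_le_mul_right (h x ((PMF.mem_support_iff _ _).2 hx)) _

theorem mean_mono {p : PMF α} {f g : α → ℝ≥0∞} (h : ∀ x, f x ≤ g x) :
    mean p f ≤ mean p g := mean_mono_support fun x _ => h x

theorem mean_const (p : PMF α) (a : ℝ≥0∞) : mean p (fun _ => a) = a := by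
  rw [mean, ENNReal.tsum_mul_right, p.tsum_coe, one_mul]

theorem mean_add (p : PMF α) (f g : α → ℝ≥0∞) :
    mean p (fun x => f x + g x) = mean p f + mean p g := by
  simp only [mean, mul_add, ENNReal.tsum_add]

theorem mean_const_mul (p : PMF α) (a : ℝ≥0∞) (f : α → ℝ≥0∞) :
    mean p (fun x => a * f x) = a * mean p f := by
  simp only [mean, ← ENNReal.tsum_mul_left]
  exact tsum_congr fun x => by ring

theorem mean_sum {ι : Type*} (s : Finset ι) (p : PMF α) (f : ι → α → ℝ≥0∞) :
    mean p (fun x => ∑ i ∈ s, f i x) = ∑ i ∈ s, mean p (f i) := by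
  classical
  induction s using Finset.induction_on with
  | empty => simp [mean]
  | insert i s hi ih => simp only [Finset.sum_insert hi, mean_add, ih]

theorem mean_ite_eq [DecidableEq α] (p : PMF α) (g : α) (a b : ℝ≥0∞) :
    mean p (fun v => if v = g then a else b) = p g * a + (1 - p g) * b := by
  have h1 : mean p (fun v => if v = g then 1 else 0) = p g := by
    rw [mean, tsum_eq_single g]
    · simp
    · intro v hv
      simp [hv]
  have h2 : mean p (fun v => if v = g then 0 else 1) = 1 - p g := by
    refine ENNReal.eq_sub_of_add_eq (PMF.apply_ne_top _ _) ?_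
    rw [← h1, ← mean_add]
    refine Eq.trans ?_ (mean_const p 1)
    congr 1
    funext v
    split_ifs <;> simp
  calc mean p (fun v => if v = g then a else b)
      = mean p (fun v => a * (if v = g then 1 else 0) + b * (if v = g then 0 else 1)) := by
        congr 1
        funext v
        split_ifs <;> simp
    _ = _ := by rw [mean_add, mean_const_mul, mean_const_mul, h1, h2, mul_comm a, mul_comm b]

end Mean

/-! ### State laws under time-dependent policies -/

section Law

variable {S A : Type*} (M : AMDP S A)

theorem lawAfter_congr {σ τ : ℕ → Policy S A} (s : S) (n : ℕ) (h : ∀ i < n, σ i = τ i) :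
    M.lawAfter σ s n = M.lawAfter τ s n := by
  induction n with
  | zero => rfl
  | succ n ih =>
    simp only [lawAfter, ih fun i hi => h i (hi.trans n.lt_succ_self), h n n.lt_succ_self]

theorem lawAfter_add (σ : ℕ → Policy S A) (s : S) (m n : ℕ) :
    M.lawAfter σ s (m + n) =
      (M.lawAfter σ s m).bind fun u => M.lawAfter (fun i => σ (m + i)) u n := by
  induction n with
  | zero => simp [lawAfter]
  | succ n ih =>
    rw [← add_assoc, lawAfter, ih, PMF.bind_bind]
    rfl

theorem lawAfter_succ_left (σ : ℕ → Policy S A) (s : S) (n : ℕ) :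
    M.lawAfter σ s (n + 1) =
      (M.trans s (σ 0 s)).bind fun u => M.lawAfter (fun i => σ (i + 1)) u n := by
  rw [add_comm n 1, lawAfter_add]
  simp [lawAfter, add_comm]

theorem stateLaw_add (π : Policy S A) (m n : ℕ) :
    M.stateLaw π (m + n) = (M.stateLaw π m).bind fun u => M.lawAfter (fun _ => π) u n :=
  M.lawAfter_add _ _ _ _

theorem sum_trans [Fintype S] (s : S) (a : A) : ∑ u, M.trans s a u = 1 := by
  rw [← tsum_fintype (L := SummationFilter.unconditional _), PMF.tsum_coe]

theorem lawAfter_stay {s : S} {a : A} (h : M.trans s a s = 1) {σ : ℕ → Policy S A} {n : ℕ}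
    (hσ : ∀ i < n, σ i s = a) : M.lawAfter σ s n = PMF.pure s := by
  have hp : M.trans s a = PMF.pure s := by
    have h1 := (PMF.apply_eq_one_iff _ _).1 h
    ext u
    by_cases hu : u = s
    · simp [hu, h]
    · have : u ∉ (M.trans s a).support := by rw [h1]; exact hu
      rw [PMF.pure_apply, if_neg hu]
      exact (PMF.apply_eq_zero_iff _ _).2 this
  induction n with
  | zero => rfl
  | succ n ih =>
    rw [lawAfter, ih fun i hi => hσ i (hi.trans n.lt_succ_self), PMF.pure_bind,
      hσ n n.lt_succ_self, hp]

end Law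

/-! ### Hitting times and existence of the switching policies -/

section Hitting

variable {S A : Type*} (M : AMDP S A) [Fintype S] [DecidableEq S]

theorem firstHitProb_succ {π : Policy S A} {g s : S} (h : s ≠ g) (n : ℕ) :
    M.firstHitProb π g (n + 1) s = ∑ u, M.trans s (π s) u * M.firstHitProb π g n u := by
  simp [firstHitProb, h]

theorem sum_firstHitProb_le_one (π : Policy S A) (g : S) (n : ℕ) (s : S) :
    ∑ i ∈ Finset.range n, M.firstHitProb π g i s ≤ 1 := by
  induction n generalizing s with
  | zero => simp
  | succ n ih =>
    rw [Finset.sum_range_succ']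
    by_cases h : s = g
    · simp [firstHitProb, h]
    · simp only [M.firstHitProb_succ h]
      rw [Finset.sum_comm]
      simp only [← Finset.mul_sum]
      calc _ ≤ ∑ u, M.trans s (π s) u * 1 + 0 :=
            add_le_add (Finset.sum_le_sum fun u _ => mul_le_mul_right (ih u) _)
              (by simp [firstHitProb, h])
        _ = 1 := by simp [sum_trans]

theorem tsum_firstHitProb_le_one (π : Policy S A) (g s : S) :
    ∑' i, M.firstHitProb π g i s ≤ 1 := by
  rw [ENNReal.tsum_eq_iSup_nat]
  exact iSup_le fun n => M.sum_firstHitProb_le_one π g n s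

theorem firstHitProb_le_lawAfter (π : Policy S A) (g : S) (n : ℕ) (s : S) :
    M.firstHitProb π g n s ≤ M.lawAfter (fun _ => π) s n g := by
  induction n generalizing s with
  | zero => simp [firstHitProb, lawAfter, PMF.pure_apply, eq_comm (a := g)]
  | succ n ih =>
    by_cases h : s = g
    · simp [firstHitProb, h]
    · rw [M.firstHitProb_succ h, lawAfter_succ_left, PMF.bind_apply, tsum_fintype]
      exact Finset.sum_le_sum fun u _ => mul_le_mul_right (ih u) _

theorem expHitTime_self (π : Policy S A) (g : S) : M.expHitTime π g g = 0 := by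
  have h : ∀ n, n ≠ 0 → M.firstHitProb π g n g = 0 := by
    intro n hn
    obtain ⟨m, rfl⟩ := Nat.exists_eq_succ_of_ne_zero hn
    simp [firstHitProb]
  have h1 : ∑' n : ℕ, (n : ℝ≥0∞) * M.firstHitProb π g n g = 0 := by
    rw [ENNReal.tsum_eq_zero]
    intro n
    rcases eq_or_ne n 0 with rfl | hn
    · simp
    · simp [h n hn]
  rw [expHitTime, h1, tsum_eq_single 0 h]
  simp [firstHitProb]

/-- First-step analysis. It makes the expected hitting time a potential that pays for one step while
the agent moves to the parking state. -/
theorem one_add_sum_expHitTime_le {π : Policy S A} {g s : S} (h : s ≠ g) :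
    1 + ∑ u, M.trans s (π s) u * M.expHitTime π g u ≤ M.expHitTime π g s := by
  set P := M.trans s (π s)
  set f := M.firstHitProb π g
  have hf0 : f 0 s = 0 := by simp [f, firstHitProb, h]
  have hF : ∑' n, f n s = ∑ u, P u * ∑' n, f n u := by
    rw [tsum_eq_zero_add' ENNReal.summable, hf0, zero_add]
    simp only [f, M.firstHitProb_succ h, ← ENNReal.tsum_mul_left]
    rw [Summable.tsum_finsetSum fun _ _ => ENNReal.summable]
  have hE : ∑' n : ℕ, (n : ℝ≥0∞) * f n s =
      ∑ u, P u * ∑' n : ℕ, (n : ℝ≥0∞) * f n u + ∑' n, f n s := by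
    rw [hF, ← Finset.sum_add_distrib, tsum_eq_zero_add' ENNReal.summable]
    simp only [f, M.firstHitProb_succ h, ← ENNReal.tsum_mul_left, ← mul_add, Nat.cast_zero,
      zero_mul, zero_add, ← ENNReal.tsum_add]
    rw [← Summable.tsum_finsetSum fun _ _ => ENNReal.summable]
    refine tsum_congr fun n => ?_
    rw [Finset.mul_sum]
    refine Finset.sum_congr rfl fun u _ => ?_
    push_cast
    ring
  have hG : ∑ u, P u * (1 - ∑' n, f n u) = 1 - ∑' n, f n s := by
    refine ENNReal.eq_sub_of_add_eq
      (ne_top_of_le_ne_top ENNReal.one_ne_top (M.tsum_firstHitProb_le_one π g s)) ?_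
    rw [hF, ← Finset.sum_add_distrib]
    refine Eq.trans ?_ (M.sum_trans s (π s))
    refine Finset.sum_congr rfl fun u _ => ?_
    rw [← mul_add, tsub_add_cancel_of_le (M.tsum_firstHitProb_le_one π g u), mul_one]
  -- The step just made is split into the mass that eventually hits `g`, which shifts the hitting
  -- times by one, and the mass that never does, which the infinite penalty absorbs.
  have hle : (1 : ℝ≥0∞) = (1 - ∑' n, f n s) + ∑' n, f n s :=
    (tsub_add_cancel_of_le (M.tsum_firstHitProb_le_one π g s)).symm
  have hinf : ∀ x : ℝ≥0∞, x + ∞ * x = ∞ * x := by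
    intro x
    rcases eq_or_ne x 0 with rfl | hx
    · simp
    · simp [ENNReal.top_mul hx]
  apply le_of_eq
  simp only [expHitTime, mul_add, Finset.sum_add_distrib]
  change 1 + (∑ u, P u * ∑' n : ℕ, (n : ℝ≥0∞) * f n u + ∑ u, P u * (∞ * (1 - ∑' n, f n u))) =
    ∑' n : ℕ, (n : ℝ≥0∞) * f n s + ∞ * (1 - ∑' n, f n s)
  have hsw : ∑ u, P u * (∞ * (1 - ∑' n, f n u)) = ∞ * (1 - ∑' n, f n s) := by
    rw [← hG, Finset.mul_sum]
    exact Finset.sum_congr rfl fun u _ => by ring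
  rw [hsw, hE]
  calc 1 + (∑ u, P u * ∑' n : ℕ, (n : ℝ≥0∞) * f n u + ∞ * (1 - ∑' n, f n s))
      = ∑ u, P u * ∑' n : ℕ, (n : ℝ≥0∞) * f n u + ∑' n, f n s +
          ((1 - ∑' n, f n s) + ∞ * (1 - ∑' n, f n s)) := by
        nth_rewrite 1 [hle]
        ring
    _ = _ := by rw [hinf]

theorem one_le_expHitTime {π : Policy S A} {g s : S} (h : s ≠ g) : 1 ≤ M.expHitTime π g s :=
  le_self_add.trans (M.one_add_sum_expHitTime_le h)

theorem one_le_diameter [Nontrivial S] : 1 ≤ M.diameter := by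
  obtain ⟨s, g, h⟩ := exists_pair_ne S
  exact (le_iInf fun _ => M.one_le_expHitTime h).trans
    (le_iSup_of_le s (le_iSup_of_le g (le_iSup_of_le h le_rfl)))

theorem exists_expHitTime_le_diameter [Finite A] [Nonempty A] {s g : S} (h : s ≠ g) :
    ∃ π : Policy S A, M.expHitTime π g s ≤ M.diameter := by
  obtain ⟨π, hπ⟩ := exists_eq_ciInf_of_finite (f := fun π : Policy S A => M.expHitTime π g s)
  exact ⟨π, hπ.le.trans (le_iSup_of_le s (le_iSup_of_le g (le_iSup_of_le h le_rfl)))⟩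

/-- A policy that reaches `g` within an expected number `D` of steps reaches it for the first time
after exactly `l` steps with probability at least `1 / (4 D)`, for some `l ≤ 2 D`. -/
theorem exists_firstHitProb_ge {π : Policy S A} {g s : S} (h : s ≠ g) {D : ℝ≥0∞} (hD : D < ⊤)
    (hπ : M.expHitTime π g s ≤ D) :
    ∃ l ≤ ⌊(2 * D).toReal⌋₊, (4 * D)⁻¹ ≤ M.firstHitProb π g l s := by
  by_contra! hcon
  set L := ⌊(2 * D).toReal⌋₊ with hL
  set f := fun n => M.firstHitProb π g n s
  have h1D : 1 ≤ D := (M.one_le_expHitTime h).trans hπ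
  have h2D : 2 * D ≠ ⊤ := ENNReal.mul_ne_top (by simp) hD.ne
  have hf0 : f 0 = 0 := by simp [f, firstHitProb, h]
  have hF : ∑' n, f n = 1 := by
    refine le_antisymm (M.tsum_firstHitProb_le_one π g s) ?_
    by_contra! hlt
    have : ∞ * (1 - ∑' n, f n) = ⊤ := ENNReal.top_mul (tsub_pos_of_lt hlt).ne'
    have h2 : M.expHitTime π g s = ⊤ := by
      simp only [expHitTime]
      change _ + ∞ * (1 - ∑' n, f n) = ⊤
      rw [this, add_top]
    rw [h2] at hπ
    exact absurd hπ (not_le.2 hD)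
  have hE : ∑' n : ℕ, (n : ℝ≥0∞) * f n ≤ D := le_self_add.trans hπ
  -- Time `0` does not contribute because `s ≠ g`, so only `L` terms remain.
  have hsum : ∑ n ∈ Finset.range (L + 1), f n ≤ L * (4 * D)⁻¹ := by
    rw [Finset.sum_range_succ', hf0, add_zero]
    calc _ ≤ ∑ n ∈ Finset.range L, (4 * D)⁻¹ := Finset.sum_le_sum fun i hi =>
          (hcon (i + 1) (by simpa using hi)).le
      _ = _ := by simp
  -- Markov's inequality: each hitting time beyond `L` is at least `L + 1`. As `L ≤ 2D` bounds the
  -- mass up to `L` by `1/2`, this gives `(L + 1)/2 ≤ D`, against `L + 1 > 2D`.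
  have hkey : ((L : ℝ≥0∞) + 1) * ∑' n, f n ≤
      ∑' n : ℕ, (n : ℝ≥0∞) * f n + (L + 1) * ∑ n ∈ Finset.range (L + 1), f n := by
    have : ∑ n ∈ Finset.range (L + 1), f n =
        ∑' n, if n ∈ Finset.range (L + 1) then f n else 0 := by
      rw [tsum_eq_sum (s := Finset.range (L + 1))]
      · exact Finset.sum_congr rfl fun i hi => by simp only [hi, if_true]
      · intro b hb
        simp only [hb, if_false]
    rw [this, ← ENNReal.tsum_mul_left, ← ENNReal.tsum_mul_left, ← ENNReal.tsum_add]
    refine ENNReal.tsum_le_tsum fun n => ?_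
    split_ifs with hn
    · exact le_add_self
    · rw [mul_zero, add_zero]
      have : L + 1 ≤ n := by simpa using hn
      exact mul_le_mul_left (by exact_mod_cast this) _
  rw [hF, mul_one] at hkey
  have hfin : ((L : ℝ≥0∞) + 1) ≤ D + (L + 1) * (L * (4 * D)⁻¹) :=
    hkey.trans (add_le_add hE (mul_le_mul_right hsum _))
  lift D to NNReal using hD.ne
  have h1D' : (1 : ℝ) ≤ D := by exact_mod_cast h1D
  have hL1 : (L : ℝ) ≤ 2 * D := by
    have := Nat.floor_le (a := (2 * (D : ℝ≥0∞)).toReal) ENNReal.toReal_nonneg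
    simpa [hL] using this
  have hL2 : (2 : ℝ) * D < L + 1 := by
    have := Nat.lt_floor_add_one (2 * (D : ℝ≥0∞)).toReal
    simpa [hL] using this
  have hD0 : (4 * D : NNReal) ≠ 0 := by
    have : (D : ℝ) ≠ 0 := by linarith
    simpa using this
  have hreal : (L : ℝ) + 1 ≤ D + (L + 1) * (L * ((4 * D : NNReal)⁻¹ : NNReal)) := by
    have h4 : (4 * (D : ℝ≥0∞))⁻¹ = ((4 * D : NNReal)⁻¹ : NNReal) := by
      rw [ENNReal.coe_inv hD0]
      simp
    rw [h4] at hfin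
    exact_mod_cast hfin
  push_cast at hreal
  have h5 : (L : ℝ) * (4 * (D : ℝ))⁻¹ ≤ 1 / 2 := by
    rw [← div_eq_mul_inv, div_le_iff₀ (by linarith)]
    linarith
  nlinarith

/-- The favourable hitting time `l` depends on the target; waiting in the parking state for the
first `L - l` steps gives all targets the common length `L = ⌊2D⌋`. -/
theorem nonempty_switchPlan [Nontrivial S] [Finite A] {sStar : S} {aStar : A}
    (h : M.trans sStar aStar sStar = 1) (hD : M.diameter < ⊤) :
    Nonempty (M.SwitchPlan sStar) := by
  classical
  have : Nonempty A := ⟨aStar⟩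
  have h1 : ∀ s, ∃ π : Policy S A, s ≠ sStar → M.expHitTime π sStar s ≤ M.diameter := by
    intro s
    by_cases hs : s = sStar
    · exact ⟨fun _ => aStar, fun h => absurd hs h⟩
    · obtain ⟨π, hπ⟩ := M.exists_expHitTime_le_diameter hs
      exact ⟨π, fun _ => hπ⟩
  set L := ⌊(2 * M.diameter).toReal⌋₊ with hL
  have h2 : ∀ g, ∃ σ : ℕ → Policy S A, (4 * M.diameter)⁻¹ ≤ M.lawAfter σ sStar L g := by
    intro g
    by_cases hg : sStar = g
    · refine ⟨fun _ _ => aStar, ?_⟩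
      rw [M.lawAfter_stay h fun _ _ => rfl, ← hg, PMF.pure_apply_self, ENNReal.inv_le_one]
      exact M.one_le_diameter.trans (le_mul_of_one_le_left' (by norm_num))
    · obtain ⟨π, hπ⟩ := M.exists_expHitTime_le_diameter hg
      obtain ⟨l, hl, hl'⟩ := M.exists_firstHitProb_ge hg hD hπ
      refine ⟨fun i => if i < L - l then fun _ => aStar else π, hl'.trans ?_⟩
      rw [show M.lawAfter (fun i => if i < L - l then fun _ => aStar else π) sStar L =
          M.lawAfter (fun i => if i < L - l then fun _ => aStar else π) sStar (L - l + l) by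
        rw [Nat.sub_add_cancel hl], lawAfter_add, M.lawAfter_stay (a := aStar) h (fun i hi => by simp [hi]),
        PMF.pure_bind]
      simpa using M.firstHitProb_le_lawAfter π g l sStar
  choose toStar htoStar using h1
  choose aim haim using h2
  refine ⟨⟨toStar, htoStar, L, ?_, aim, haim⟩⟩
  have h2D : 2 * M.diameter ≠ ⊤ := ENNReal.mul_ne_top (by simp) hD.ne
  calc (L : ℝ≥0∞) = ENNReal.ofReal L := (ENNReal.ofReal_natCast L).symm
    _ ≤ ENNReal.ofReal (2 * M.diameter).toReal :=
        ENNReal.ofReal_le_ofReal (Nat.floor_le ENNReal.toReal_nonneg)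
    _ = _ := ENNReal.ofReal_toReal h2D

end Hitting

/-! ### A potential for the switching procedure -/

section Plan

variable {S A : Type*} [Fintype S] [DecidableEq S] {M : AMDP S A} {sStar : S}
  (W : M.SwitchPlan sStar)

/-- `p* = min_g p_g`. -/
def SwitchPlan.minProb : ℝ≥0∞ := ⨅ s, W.succProb s

theorem SwitchPlan.minProb_ge : (4 * M.diameter)⁻¹ ≤ W.minProb := le_iInf W.aim_spec

theorem SwitchPlan.minProb_le_one : W.minProb ≤ 1 :=
  (iInf_le _ sStar).trans (PMF.coe_le_one _ _)

theorem SwitchPlan.succProb_ne_top (g : S) : W.succProb g ≠ ⊤ := PMF.apply_ne_top _ _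

theorem SwitchPlan.minProb_ne_top : W.minProb ≠ ⊤ :=
  ne_top_of_le_ne_top ENNReal.one_ne_top W.minProb_le_one

theorem SwitchPlan.minProb_ne_zero (hD : M.diameter < ⊤) : W.minProb ≠ 0 := by
  refine (lt_of_lt_of_le ?_ W.minProb_ge).ne'
  exact ENNReal.inv_pos.2 (ENNReal.mul_ne_top (by simp) hD.ne)

/-- The purpose of the coin: the success probability no longer depends on the target, so success
does not bias its law. -/
theorem SwitchPlan.succProb_mul_acceptProb (hD : M.diameter < ⊤) (g : S) :
    W.succProb g * W.acceptProb g = W.minProb := by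
  refine ENNReal.mul_div_cancel (fun h => ?_) (W.succProb_ne_top g)
  exact W.minProb_ne_zero hD (le_antisymm ((iInf_le _ g).trans h.le) bot_le)

/-- An attempt of length zero could only hit the parking state. Positivity ensures that an attempt
just begun still has a step to make. -/
theorem SwitchPlan.len_pos [Nontrivial S] (hD : M.diameter < ⊤) : 0 < W.len := by
  rw [Nat.pos_iff_ne_zero]
  intro h
  obtain ⟨g, hg⟩ := exists_ne sStar
  have h1 := W.aim_spec g
  rw [h, lawAfter, PMF.pure_apply, if_neg hg] at h1
  have h2 : (4 * M.diameter)⁻¹ ≠ 0 := ENNReal.inv_ne_zero.2 (ENNReal.mul_ne_top (by simp) hD.ne)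
  exact h2 (le_antisymm h1 bot_le)

/-- Law of the final state of an attempt at `g` that is in `u` after `k` steps. -/
def SwitchPlan.attempt (g : S) (k : ℕ) (u : S) : PMF S :=
  M.lawAfter (fun i => W.aim g (k + i)) u (W.len - k)

theorem SwitchPlan.attempt_step {k : ℕ} (hk : k < W.len) (g u : S) :
    W.attempt g k u = (M.trans u (W.aim g k u)).bind (W.attempt g (k + 1)) := by
  have : W.len - k = W.len - (k + 1) + 1 := by omega
  rw [attempt, this, lawAfter_succ_left]
  refine congrArg _ (funext fun v => ?_)
  rw [attempt]
  exact M.lawAfter_congr _ _ fun i _ => by rw [add_assoc, add_comm 1]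

/-- A potential for one run of the switching procedure: the value is `x n s` if the procedure has
returned at the beginning of slot `n` in the state `s`, `z o s` if the agent moves from `o` to the
parking state, it is at most `y` when the loop is repeated, and `κ` is paid per step. -/
def switchValue (κ : ℝ≥0∞) (x : ℕ → S → ℝ≥0∞) (y : ℝ≥0∞) (z : S → S → ℝ≥0∞) (n : ℕ) :
    Phase S → S → ℝ≥0∞
  | .play, s => x n s
  | .moving o, s => z o s
  | .aiming g k, s => κ * (W.len - k : ℕ) + mean (W.attempt g k s) fun v =>
      if v = g then W.acceptProb g * x (n + (W.len - k)) g + (1 - W.acceptProb g) * y else y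

variable {W} {κ y : ℝ≥0∞} {x : ℕ → S → ℝ≥0∞} {z : S → S → ℝ≥0∞} {n : ℕ}

theorem switchValue_aiming_start (hD : M.diameter < ⊤) (g : S) :
    switchValue W κ x y z n (.aiming g 0) sStar =
      κ * W.len + (W.minProb * x (n + W.len) g + (1 - W.minProb) * y) := by
  simp only [switchValue, Nat.sub_zero, mean_ite_eq]
  have h1 : W.attempt g 0 sStar g = W.succProb g := by
    simp [SwitchPlan.attempt, SwitchPlan.succProb]
  have h2 : W.succProb g * (1 - W.acceptProb g) + (1 - W.succProb g) = 1 - W.minProb := by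
    refine ENNReal.eq_sub_of_add_eq W.minProb_ne_top ?_
    rw [← W.succProb_mul_acceptProb hD g]
    calc _ = W.succProb g * (1 - W.acceptProb g + W.acceptProb g) + (1 - W.succProb g) := by ring
      _ = 1 := by
        rw [tsub_add_cancel_of_le (W.acceptProb_le_one g), mul_one]
        exact add_tsub_cancel_of_le (PMF.coe_le_one _ _)
  rw [h1, ← h2, ← W.succProb_mul_acceptProb hD g]
  ring

theorem switchValue_zero (φ : Phase S) (s : S) : switchValue W 0 0 0 0 n φ s = 0 := by
  cases φ <;> simp [switchValue, mean]

/-- While aiming, the potential is a conditional expectation, so the Markov property suffices; while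
moving, `hz` is precisely what is needed. -/
theorem switchValue_step (hz : ∀ o s, s ≠ sStar →
      κ + mean (M.trans s (W.toStar o s)) (z o) ≤ z o s) (c : Config S A)
    (hplay : c.phase ≠ .play) (hmove : ∀ o, c.phase = .moving o → c.state ≠ sStar)
    (haim : ∀ g k, c.phase = .aiming g k → k < W.len) :
    κ + mean (M.trans c.state (action W c)) (switchValue W κ x y z (n + 1) (nextPhase c.phase)) ≤
      switchValue W κ x y z n c.phase c.state := by
  rcases c with ⟨s, b, π, φ, est, tot⟩
  cases φ with
  | play => exact absurd rfl hplay
  | moving o => exact hz o s (hmove o rfl)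
  | aiming g k =>
    have hk : k < W.len := haim g k rfl
    have h1 : n + 1 + (W.len - (k + 1)) = n + (W.len - k) := by omega
    have h2 : W.len - k = (W.len - (k + 1)) + 1 := by omega
    simp only [action, nextPhase]
    change κ + mean (M.trans s (W.aim g k s)) (fun u => switchValue W κ x y z (n + 1)
      (.aiming g (k + 1)) u) ≤ _
    simp only [switchValue, mean_add, mean_const, h1]
    rw [W.attempt_step hk, mean_bind]
    rw [h2, Nat.cast_succ, mul_add, mul_one, ← add_assoc, ← add_assoc]
    rw [add_comm κ]

end Plan

/-! ### The potential under the random choices that precede an action -/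

section Stages

variable {S A : Type*} [Fintype S] [DecidableEq S] {M : AMDP S A} {sStar : S}
  {W : M.SwitchPlan sStar}
  {κ y e : ℝ≥0∞} {x : ℕ → S → ℝ≥0∞} {z : S → S → ℝ≥0∞} {n : ℕ}

/-- Only the phase changes here, so a potential that is `switchValue` plus a phase-independent part
`e` can be compared directly. The condition `hz` says that restarting the loop is worth no more than
the `y` budgeted for failure. -/
theorem mean_finishAttempt_le {c : Config S A} {V : Config S A → ℝ≥0∞}
    (hV : ∀ φ, V { c with phase := φ } = e + switchValue W κ x y z n φ c.state)
    (hz : ∀ s, z s s ≤ y) : mean (finishAttempt W c) V ≤ V c := by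
  rcases c with ⟨s, b, π, φ, est, tot⟩
  cases φ with
  | play => exact (mean_pure _ _).le
  | moving o => exact (mean_pure _ _).le
  | aiming g k =>
    simp only [finishAttempt]
    split_ifs with hk hs
    · have hg := hV (.aiming g k)
      simp only at hg hs
      rw [mean_map]
      rw [hV]
      simp only [hV]
      rw [hk, hs, mean_add, mean_const]
      refine add_le_add le_rfl ?_
      simp only [switchValue, SwitchPlan.attempt, Nat.sub_self, lawAfter, mean_pure, add_zero,
        Nat.cast_zero, mul_zero, zero_add, if_true]
      rw [mean, tsum_fintype, Fintype.sum_bool]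
      simp only [SwitchPlan.coin, PMF.ofFintype_apply, if_true, Bool.false_eq_true, if_false]
      exact add_le_add le_rfl (mul_le_mul_right (hz g) _)
    · have hg := hV (.aiming g k)
      simp only at hg hs
      rw [mean_pure, hV, hV, hk]
      refine add_le_add le_rfl ?_
      simp only [switchValue, SwitchPlan.attempt, Nat.sub_self, lawAfter, mean_pure, add_zero,
        Nat.cast_zero, mul_zero, zero_add, if_neg hs]
      exact hz s
    · exact (mean_pure _ _).le

theorem mean_beginAttempt_le (hD : M.diameter < ⊤) {c : Config S A} {V : Config S A → ℝ≥0∞}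
    (hV : ∀ φ, V { c with phase := φ } = e + switchValue W κ x y z n φ c.state)
    (hz : ∀ o, κ * W.len + (W.minProb * mean (M.stateLaw c.policy (n + W.len)) (x (n + W.len)) +
      (1 - W.minProb) * y) ≤ z o sStar) : mean (beginAttempt W n c) V ≤ V c := by
  rcases c with ⟨s, b, π, φ, est, tot⟩
  cases φ with
  | play => exact (mean_pure _ _).le
  | aiming g k => exact (mean_pure _ _).le
  | moving o =>
    simp only [beginAttempt]
    split_ifs with hs
    · simp only at hV hs hz
      rw [mean_map, hV]
      simp only [hV]
      simp only [hs, switchValue_aiming_start hD, mean_add, mean_const, mean_const_mul]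
      exact add_le_add le_rfl (hz o)
    · exact (mean_pure _ _).le

theorem mean_finishAttempt_of_const {c : Config S A} {V : Config S A → ℝ≥0∞}
    (hV : ∀ φ, V { c with phase := φ } = V c) : mean (finishAttempt W c) V ≤ V c :=
  mean_finishAttempt_le (κ := 0) (x := 0) (y := 0) (z := 0) (e := V c) (n := 0)
    (fun φ => by rw [hV, switchValue_zero, add_zero]) fun _ => le_rfl

theorem mean_beginAttempt_of_const (hD : M.diameter < ⊤) {c : Config S A}
    {V : Config S A → ℝ≥0∞} (hV : ∀ φ, V { c with phase := φ } = V c) :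
    mean (beginAttempt W n c) V ≤ V c :=
  mean_beginAttempt_le (κ := 0) (x := 0) (y := 0) (z := 0) (e := V c) hD
    (fun φ => by rw [hV, switchValue_zero, add_zero]) fun _ => by simp [mean]

end Stages

theorem occupancy_nonneg {S A : Type*} [DecidableEq A] {M : AMDP S A} (π : Policy S A) (t : ℕ)
    (s : S) (a : A) : 0 ≤ M.occupancy π t s a := by
  rw [occupancy]
  split_ifs <;> simp

theorem lossEstimate_nonneg {S A : Type*} [Fintype S] [DecidableEq S] [Fintype A]
    [DecidableEq A] {M : AMDP S A} (p : PMF (Policy S A)) (t : ℕ) (s₀ : S) (a₀ : A) {l : ℝ}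
    (hl : 0 ≤ l) (s : S) (a : A) : 0 ≤ lossEstimate (M := M) p t s₀ a₀ l s a := by
  rw [lossEstimate]
  split_ifs
  · exact div_nonneg hl (Finset.sum_nonneg fun π _ =>
      mul_nonneg ENNReal.toReal_nonneg (occupancy_nonneg _ _ _ _))
  · exact le_rfl

/-! ### Invariants of reachable configurations and supermartingale bounds -/

section Invariant

variable {S A : Type*} [Fintype S] [DecidableEq S] {M : AMDP S A} {sStar : S}

/-- Properties of the configurations that occur with positive probability before slot `n`. -/
structure Reachable (W : M.SwitchPlan sStar) (H n : ℕ) (c : Config S A) : Prop where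
  begun_le : (c.begun - 1) * H ≤ n
  play_ne_zero : c.phase = .play → M.stateLaw c.policy n c.state ≠ 0
  steps_le : ∀ g k, c.phase = .aiming g k → k ≤ W.len
  target_ne_zero : ∀ g k, c.phase = .aiming g k → M.stateLaw c.policy (n + (W.len - k)) g ≠ 0
  est_eq_zero : ∀ t, n ≤ t → c.est t = 0
  est_nonneg : ∀ t s a, 0 ≤ c.est t s a
  total_nonneg : 0 ≤ c.total
  total_le : c.total ≤ n

/-- A reachable configuration after the pending attempt has been finished. -/
structure Finished (W : M.SwitchPlan sStar) (H n : ℕ) (c : Config S A) : Prop extends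
    Reachable W H n c where
  steps_lt : ∀ g k, c.phase = .aiming g k → k < W.len

/-- A reachable configuration after the epoch that is due has been begun. -/
structure Begun (W : M.SwitchPlan sStar) (H n : ℕ) (c : Config S A) : Prop extends
    Finished W H n c where
  lt_begun : c.phase = .play → n < c.begun * H

/-- A reachable configuration in which the action of slot `n` is taken. -/
structure Ready (W : M.SwitchPlan sStar) (H n : ℕ) (c : Config S A) : Prop extends
    Begun W H n c where
  state_ne : ∀ o, c.phase = .moving o → c.state ≠ sStar

variable {W : M.SwitchPlan sStar} {H n : ℕ} {c c' : Config S A}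

theorem Reachable.finishAttempt (hc : Reachable W H n c)
    (h : c' ∈ (finishAttempt W c).support) : Finished W H n c' := by
  rcases c with ⟨s, b, π, φ, est, tot⟩
  have h1 := hc.begun_le
  have h2 := hc.est_eq_zero
  have h3 := hc.est_nonneg
  have h4 := hc.total_nonneg
  have h5 := hc.total_le
  cases φ with
  | play =>
    obtain rfl : c' = _ := by simpa [AMDP.finishAttempt] using h
    exact ⟨hc, fun g k hk => by simp at hk⟩
  | moving o =>
    obtain rfl : c' = _ := by simpa [AMDP.finishAttempt] using h
    exact ⟨hc, fun g k hk => by simp at hk⟩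
  | aiming g k =>
    simp only [AMDP.finishAttempt] at h
    split_ifs at h with hk hs
    · rw [PMF.support_map] at h
      obtain ⟨b, -, rfl⟩ := h
      refine ⟨⟨h1, ?_, ?_, ?_, h2, h3, h4, h5⟩, ?_⟩
      · intro _
        -- On return no steps are left and the state is the target, which was drawn from the state
        -- law of this very slot.
        have := hc.target_ne_zero g k rfl
        simpa [hk, hs] using this
      all_goals intro g' k' hk'; cases b <;> simp at hk'
    · obtain rfl : c' = _ := by simpa using h
      refine ⟨⟨h1, ?_, ?_, ?_, h2, h3, h4, h5⟩, ?_⟩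
      · intro h; simp at h
      all_goals intro g' k' hk'; simp at hk'
    · obtain rfl : c' = _ := by simpa using h
      refine ⟨hc, fun g' k' hk' => ?_⟩
      have := hc.steps_le g k rfl
      obtain ⟨rfl, rfl⟩ := Phase.aiming.inj hk'
      omega

theorem Begun.beginAttempt (hl : 0 < W.len) (hc : Begun W H n c)
    (h : c' ∈ (beginAttempt W n c).support) : Ready W H n c' := by
  rcases c with ⟨s, b, π, φ, est, tot⟩
  cases φ with
  | moving o =>
    simp only [AMDP.beginAttempt] at h
    split_ifs at h with hb
    · rw [PMF.support_map] at h
      obtain ⟨g, hg, rfl⟩ := h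
      refine ⟨⟨⟨⟨hc.begun_le, ?_, ?_, ?_, hc.est_eq_zero, hc.est_nonneg, hc.total_nonneg,
        hc.total_le⟩, ?_⟩, ?_⟩, ?_⟩
      · simp
      · simp only [Phase.aiming.injEq]; omega
      · rintro _ _ ⟨⟩
        simpa [PMF.mem_support_iff] using hg
      · simp only [Phase.aiming.injEq]; omega
      · simp
      · simp
    · obtain rfl : c' = _ := by simpa using h
      exact ⟨hc, fun _ _ => hb⟩
  | play =>
    obtain rfl : c' = _ := by simpa [AMDP.beginAttempt] using h
    exact ⟨hc, fun _ h => by simp at h⟩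
  | aiming g k =>
    obtain rfl : c' = _ := by simpa [AMDP.beginAttempt] using h
    exact ⟨hc, fun _ h => by simp at h⟩

variable [Fintype A] [DecidableEq A] [Nonempty A] {η : ℝ}

theorem Finished.beginEpoch (hc : Finished W H n c)
    (h : c' ∈ (beginEpoch (M := M) η H n c).support) : Begun W H n c' := by
  rcases c with ⟨s, b, π, φ, est, tot⟩
  cases φ with
  | play =>
    simp only [AMDP.beginEpoch] at h
    split_ifs at h with hb
    · rw [PMF.support_map] at h
      obtain ⟨π', -, rfl⟩ := h
      refine ⟨⟨⟨by simpa using hb, ?_, ?_, ?_, hc.est_eq_zero, hc.est_nonneg, hc.total_nonneg,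
        hc.total_le⟩, ?_⟩, ?_⟩
      all_goals simp
    · obtain rfl : c' = _ := by simpa using h
      exact ⟨hc, fun _ => not_le.1 hb⟩
  | moving o =>
    obtain rfl : c' = _ := by simpa [AMDP.beginEpoch] using h
    exact ⟨hc, fun h => by simp at h⟩
  | aiming g k =>
    obtain rfl : c' = _ := by simpa [AMDP.beginEpoch] using h
    exact ⟨hc, fun h => by simp at h⟩

/-- The configuration after slot `n` when the environment moves to `s'`. -/
def advance (W : M.SwitchPlan sStar) (η : ℝ) (H n : ℕ) (c : Config S A) (s' : S) : Config S A where
  state := s'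
  begun := c.begun
  policy := c.policy
  phase := nextPhase c.phase
  est := nextEst (M := M) η H n c
  total := c.total + M.loss n c.state (action W c)

theorem nextEst_of_ne_play {c : Config S A} (h : c.phase ≠ .play) :
    nextEst (M := M) η H n c = c.est := by
  rcases c with ⟨s, b, π, φ, est, tot⟩
  cases φ <;> simp_all [nextEst]

theorem nextEst_of_play {c : Config S A} (h : c.phase = .play) :
    nextEst (M := M) η H n c = Function.update c.est n
        (lossEstimate (M := M) (M.hedge η c.est ((c.begun - 1) * H)) n c.state
          (c.policy c.state) (M.loss n c.state (c.policy c.state))) := by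
  rcases c with ⟨s, b, π, φ, est, tot⟩
  obtain rfl : φ = .play := h
  rfl

theorem nextEst_apply_of_ne {c : Config S A} {t : ℕ} (h : t ≠ n) :
    nextEst (M := M) η H n c t = c.est t := by
  by_cases hp : c.phase = .play
  · rw [nextEst_of_play hp, Function.update_of_ne h]
  · rw [nextEst_of_ne_play hp]

theorem Ready.advance (hc : Ready W H n c) {s' : S}
    (hs' : s' ∈ (M.trans c.state (action W c)).support) :
    Reachable W H (n + 1) (AMDP.advance W η H n c s') := by
  have h1 : ((AMDP.advance W η H n c s').begun - 1) * H ≤ n + 1 := hc.begun_le.trans n.le_succ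
  have h2 : ∀ t, n + 1 ≤ t → (AMDP.advance W η H n c s').est t = 0 := fun t ht =>
    (nextEst_apply_of_ne (by omega)).trans (hc.est_eq_zero t (by omega))
  have h3 : ∀ t s a, 0 ≤ (AMDP.advance W η H n c s').est t s a := by
    intro t s a
    by_cases ht : t = n
    · subst ht
      by_cases hp : c.phase = .play
      · simp only [AMDP.advance, nextEst_of_play hp, Function.update_self]
        exact lossEstimate_nonneg _ _ _ _ (M.loss_nonneg _ _ _) _ _
      · simp only [AMDP.advance, nextEst_of_ne_play hp]
        exact hc.est_nonneg _ _ _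
    · simp only [AMDP.advance, nextEst_apply_of_ne ht]
      exact hc.est_nonneg _ _ _
  have h4 : 0 ≤ (AMDP.advance W η H n c s').total :=
    add_nonneg hc.total_nonneg (M.loss_nonneg _ _ _)
  have h5 : (AMDP.advance W η H n c s').total ≤ (n + 1 : ℕ) := by
    push_cast
    exact add_le_add hc.total_le (M.loss_le_one _ _ _)
  have aim_of : ∀ g k, (AMDP.advance W η H n c s').phase = .aiming g k →
      ∃ k', c.phase = .aiming g k' ∧ k = k' + 1 := by
    rcases c with ⟨s, b, π, φ, est, tot⟩
    cases φ <;> simp [AMDP.advance, nextPhase, eq_comm]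
  refine ⟨h1, ?_, ?_, ?_, h2, h3, h4, h5⟩
  · intro hp
    have hp' : c.phase = .play := by
      rcases c with ⟨s, b, π, φ, est, tot⟩
      cases φ <;> simp_all [AMDP.advance, nextPhase]
    have hact : action W c = c.policy c.state := by
      rcases c with ⟨s, b, π, φ, est, tot⟩
      obtain rfl : φ = .play := hp'
      rfl
    rw [hact] at hs'
    simp only [AMDP.advance, stateLaw, lawAfter]
    rw [← PMF.mem_support_iff, PMF.mem_support_bind_iff]
    exact ⟨c.state, (PMF.mem_support_iff _ _).2 (hc.play_ne_zero hp'), hs'⟩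
  · intro g k hk
    obtain ⟨k', hk', rfl⟩ := aim_of g k hk
    exact hc.steps_lt g k' hk'
  · intro g k hk
    obtain ⟨k', hk', rfl⟩ := aim_of g k hk
    have h6 := hc.target_ne_zero g k' hk'
    have h7 := hc.steps_lt g k' hk'
    rwa [show n + 1 + (W.len - (k' + 1)) = n + (W.len - k') by omega]

theorem slot_eq (c : Config S A) : slot W η H n c =
    (finishAttempt W c).bind fun c₁ => (beginEpoch (M := M) η H n c₁).bind fun c₂ =>
      (beginAttempt W n c₂).bind fun c₃ =>
        (M.trans c₃.state (action W c₃)).map (advance W η H n c₃) := rfl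

theorem Reachable.slot (hl : 0 < W.len) (hc : Reachable W H n c)
    (h : c' ∈ (slot W η H n c).support) : Reachable W H (n + 1) c' := by
  rw [slot_eq] at h
  simp only [PMF.mem_support_bind_iff, PMF.support_map] at h
  obtain ⟨c₁, h₁, c₂, h₂, c₃, h₃, s', hs', rfl⟩ := h
  exact ((hc.finishAttempt h₁).beginEpoch h₂ |>.beginAttempt hl h₃).advance hs'

theorem reachable_run (hl : 0 < W.len) (h : c ∈ (run W η H n).support) : Reachable W H n c := by
  induction n generalizing c with
  | zero =>
    obtain rfl : c = initConfig W := by simpa [run] using h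
    refine ⟨by simp [initConfig], fun _ => ?_, ?_, ?_, fun _ _ => rfl, fun _ _ _ => le_rfl, le_rfl,
      by simp [initConfig]⟩
    · simp [initConfig, stateLaw, lawAfter]
    all_goals simp [initConfig]
  | succ n ih =>
    simp only [run, PMF.mem_support_bind_iff] at h
    obtain ⟨c₀, h₀, h⟩ := h
    exact (ih h₀).slot hl h

/-- A mean sees only the support, so each stage has to be checked only on configurations with the
invariant valid at that point. -/
theorem mean_slot_le (hl : 0 < W.len) {V V' : Config S A → ℝ≥0∞} (hc : Reachable W H n c)
    (h1 : ∀ c, Reachable W H n c → mean (AMDP.finishAttempt W c) V ≤ V c)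
    (h2 : ∀ c, Finished W H n c → mean (AMDP.beginEpoch (M := M) η H n c) V ≤ V c)
    (h3 : ∀ c, Begun W H n c → mean (AMDP.beginAttempt W n c) V ≤ V c)
    (h4 : ∀ c, Ready W H n c →
      mean (M.trans c.state (action W c)) (fun s' => V' (AMDP.advance W η H n c s')) ≤ V c) :
    mean (AMDP.slot W η H n c) V' ≤ V c := by
  rw [slot_eq]
  simp only [mean_bind, mean_map]
  refine le_trans (mean_mono_support fun c₁ hc₁ => ?_) (h1 c hc)
  have r₁ := hc.finishAttempt hc₁
  refine le_trans (mean_mono_support fun c₂ hc₂ => ?_) (h2 c₁ r₁)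
  have r₂ := r₁.beginEpoch hc₂
  refine le_trans (mean_mono_support fun c₃ hc₃ => ?_) (h3 c₂ r₂)
  exact h4 c₃ (r₂.beginAttempt hl hc₃)

theorem mean_run_le (hl : 0 < W.len) {V : ℕ → Config S A → ℝ≥0∞} {N : ℕ}
    (h : ∀ n < N, ∀ c, Reachable W H n c → mean (AMDP.slot W η H n c) (V (n + 1)) ≤ V n c) :
    mean (run W η H N) (V N) ≤ V 0 (initConfig W) := by
  induction N with
  | zero => exact (mean_pure _ _).le
  | succ N ih =>
    rw [run, mean_bind]
    exact (mean_mono_support fun c hc => h N N.lt_succ_self c (reachable_run hl hc)).trans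
      (ih fun n hn => h n (hn.trans N.lt_succ_self))

end Invariant

/-! ### Moments of the importance weighted estimator -/

theorem mean_ofReal {α : Type*} [Fintype α] (p : PMF α) {f : α → ℝ} (hf : ∀ x, 0 ≤ f x) :
    mean p (fun x => ENNReal.ofReal (f x)) = ENNReal.ofReal (∑ x, (p x).toReal * f x) := by
  rw [mean, tsum_fintype, ENNReal.ofReal_sum_of_nonneg fun x _ =>
    mul_nonneg ENNReal.toReal_nonneg (hf x)]
  refine Finset.sum_congr rfl fun x _ => ?_
  rw [ENNReal.ofReal_mul ENNReal.toReal_nonneg, ENNReal.ofReal_toReal (PMF.apply_ne_top _ _)]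

theorem occupancy_le_one {S A : Type*} [DecidableEq A] (M : AMDP S A) (π : Policy S A)
    (t : ℕ) (s : S) (a : A) : M.occupancy π t s a ≤ 1 := by
  rw [occupancy]
  split_ifs
  · exact ENNReal.toReal_le_of_le_ofReal zero_le_one (by simpa using PMF.coe_le_one _ _)
  · exact zero_le_one

section Pairing

variable {S A : Type*} [Fintype S] [Fintype A] [DecidableEq A] (M : AMDP S A)

/-- `⟨μ_π^t, f⟩`. -/
def pairing (π : Policy S A) (t : ℕ) (f : S → A → ℝ) : ℝ := ∑ s, ∑ a, M.occupancy π t s a * f s a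

theorem pairing_zero (π : Policy S A) (t : ℕ) : M.pairing π t 0 = 0 := by simp [pairing]

theorem pairing_nonneg (π : Policy S A) (t : ℕ) {f : S → A → ℝ} (hf : ∀ s a, 0 ≤ f s a) :
    0 ≤ M.pairing π t f :=
  Finset.sum_nonneg fun s _ => Finset.sum_nonneg fun a _ =>
    mul_nonneg (occupancy_nonneg _ _ _ _) (hf s a)

theorem sum_stateLaw_mul (π : Policy S A) (t : ℕ) (f : S → A → ℝ) :
    ∑ s, (M.stateLaw π t s).toReal * f s (π s) = ∑ s, ∑ a, M.occupancy π t s a * f s a := by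
  simp [occupancy, ite_mul]

variable [DecidableEq S]

/-- Probability of a state-action pair in slot `t` when the policy is drawn from `p`. -/
def mixture (p : PMF (Policy S A)) (t : ℕ) (s : S) (a : A) : ℝ :=
  ∑ π : Policy S A, (p π).toReal * M.occupancy π t s a

theorem mixture_nonneg (p : PMF (Policy S A)) (t : ℕ) (s : S) (a : A) : 0 ≤ M.mixture p t s a :=
  Finset.sum_nonneg fun _ _ => mul_nonneg ENNReal.toReal_nonneg (occupancy_nonneg _ _ _ _)

theorem pairing_lossEstimate (p : PMF (Policy S A)) (π : Policy S A) (t : ℕ) (s : S) (a : A)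
    (l : ℝ) : M.pairing π t (lossEstimate (M := M) p t s a l) =
      M.occupancy π t s a * (l / M.mixture p t s a) := by
  rw [pairing, Finset.sum_eq_single s, Finset.sum_eq_single a]
  · simp [lossEstimate, mixture]
  · intro b _ hb; simp [lossEstimate, hb]
  · simp
  · intro u _ hu
    simp [lossEstimate, hu]
  · simp

theorem sum_mixture_mul (p : PMF (Policy S A)) (t : ℕ) (f : S → A → ℝ) :
    ∑ π : Policy S A, (p π).toReal * ∑ s, (M.stateLaw π t s).toReal * f s (π s) =
      ∑ s, ∑ a, M.mixture p t s a * f s a := by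
  simp only [sum_stateLaw_mul, mixture, Finset.mul_sum, Finset.sum_mul]
  rw [Finset.sum_comm]
  refine Finset.sum_congr rfl fun s _ => ?_
  rw [Finset.sum_comm]
  simp only [mul_assoc]

theorem mean_mixture (p : PMF (Policy S A)) (t : ℕ) {f : S → A → ℝ} (hf : ∀ s a, 0 ≤ f s a) :
    mean p (fun π => mean (M.stateLaw π t) fun s => ENNReal.ofReal (f s (π s))) =
      ENNReal.ofReal (∑ s, ∑ a, M.mixture p t s a * f s a) := by
  simp only [mean_ofReal _ fun s => hf s _]
  rw [mean_ofReal, sum_mixture_mul]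
  exact fun π => Finset.sum_nonneg fun s _ => mul_nonneg ENNReal.toReal_nonneg (hf s _)

/-- Drawing a policy from `p` and then a state from its law yields a pair with law `mixture`, which
cancels the denominator. Pairs of mixture zero are lost, whence an inequality for arbitrary `p`. -/
theorem mean_pairing_lossEstimate_le (p : PMF (Policy S A)) (ρ : Policy S A) (t : ℕ) :
    mean p (fun π => mean (M.stateLaw π t) fun s => ENNReal.ofReal
      (M.pairing ρ t (lossEstimate (M := M) p t s (π s) (M.loss t s (π s))))) ≤
      ENNReal.ofReal (∑ s, (M.stateLaw ρ t s).toReal * M.loss t s (ρ s)) := by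
  rw [M.mean_mixture p t (f := fun s a => M.pairing ρ t (lossEstimate p t s a (M.loss t s a)))
    fun s a => M.pairing_nonneg _ _ fun s' a' =>
      lossEstimate_nonneg _ _ _ _ (M.loss_nonneg _ _ _) _ _,
    sum_stateLaw_mul]
  refine ENNReal.ofReal_le_ofReal (Finset.sum_le_sum fun s _ => Finset.sum_le_sum fun a _ => ?_)
  rw [pairing_lossEstimate]
  have h0 := mul_nonneg (occupancy_nonneg (M := M) ρ t s a) (M.loss_nonneg t s a)
  rcases eq_or_ne (M.mixture p t s a) 0 with h | h
  · simpa [h] using h0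
  · apply le_of_eq
    field_simp

/-- Since occupancies and losses are at most one, a pair with mixture `q > 0` contributes at most `q
* q / q^2 = 1`, and there are `S * A` pairs. -/
theorem mean_sq_pairing_lossEstimate_le (p : PMF (Policy S A)) (t : ℕ) :
    mean p (fun π => mean (M.stateLaw π t) fun s => ENNReal.ofReal (∑ ρ : Policy S A, (p ρ).toReal *
      M.pairing ρ t (lossEstimate (M := M) p t s (π s) (M.loss t s (π s))) ^ 2)) ≤
      ENNReal.ofReal (Fintype.card S * Fintype.card A) := by
  rw [M.mean_mixture p t (f := fun s a => ∑ ρ : Policy S A, (p ρ).toReal *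
      M.pairing ρ t (lossEstimate (M := M) p t s a (M.loss t s a)) ^ 2)
    fun s a => Finset.sum_nonneg fun ρ _ => mul_nonneg ENNReal.toReal_nonneg (sq_nonneg _)]
  apply ENNReal.ofReal_le_ofReal
  calc _ ≤ ∑ _s : S, ∑ _a : A, (1 : ℝ) :=
        Finset.sum_le_sum fun s _ => Finset.sum_le_sum fun a _ => ?_
    _ = _ := by simp
  simp only [pairing_lossEstimate]
  have hq := M.mixture_nonneg p t s a
  rcases eq_or_ne (M.mixture p t s a) 0 with h | h
  · simp [h]
  · have hq' : 0 < M.mixture p t s a := lt_of_le_of_ne hq h.symm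
    calc _ ≤ M.mixture p t s a * ∑ ρ : Policy S A, (p ρ).toReal *
          (M.occupancy ρ t s a * (1 / M.mixture p t s a) ^ 2) := by
          gcongr with ρ
          rw [mul_pow]
          have h3 := occupancy_nonneg (M := M) ρ t s a
          have h1 : M.occupancy ρ t s a ^ 2 ≤ M.occupancy ρ t s a := by
            have h1 := M.occupancy_le_one ρ t s a
            nlinarith
          have h0 := M.loss_nonneg t s a
          have h2 := M.loss_le_one t s a
          gcongr
      _ = M.mixture p t s a * (M.mixture p t s a * (1 / M.mixture p t s a) ^ 2) := by
          congr 1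
          simp only [← mul_assoc, ← Finset.sum_mul]
          rfl
      _ ≤ 1 := by
          apply le_of_eq
          field_simp

end Pairing

/-! ### Exponential weights over epochs -/

section HedgeLaw

variable {S A : Type*} [Fintype S] [DecidableEq S] [Fintype A] [DecidableEq A] [Nonempty A]
  (M : AMDP S A) {η : ℝ}

theorem hedge_congr {est est' : ℕ → S → A → ℝ} {n : ℕ} (h : ∀ t < n, est t = est' t) :
    M.hedge η est n = M.hedge η est' n := by
  have hw : M.hedgeWeight η est n = M.hedgeWeight η est' n := by
    funext π
    rw [hedgeWeight, hedgeWeight]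
    congr 2
    exact Finset.sum_congr rfl fun t ht => by rw [h t (Finset.mem_range.1 ht)]
  ext π
  simp only [hedge, PMF.ofFintype_apply, hw]

theorem hedge_toReal (est : ℕ → S → A → ℝ) (n : ℕ) (π : Policy S A) :
    (M.hedge η est n π).toReal =
      M.hedgeWeight η est n π / ∑ π' : Policy S A, M.hedgeWeight η est n π' := by
  rw [hedge, PMF.ofFintype_apply, ENNReal.toReal_ofReal]
  exact div_nonneg (Real.exp_pos _).le (Finset.sum_nonneg fun _ _ => (Real.exp_pos _).le)

theorem hedge_toReal_pos (est : ℕ → S → A → ℝ) (n : ℕ) (π : Policy S A) :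
    0 < (M.hedge η est n π).toReal := by
  rw [hedge_toReal]
  exact div_pos (Real.exp_pos _) (Finset.sum_pos (fun _ _ => Real.exp_pos _) Finset.univ_nonempty)

end HedgeLaw

/-- The regret bound of the exponentially weighted average forecaster for nonnegative losses. -/
theorem exp_weights_regret {ι : Type*} [Fintype ι] {η : ℝ} (hη : 0 < η) (G : ℕ → ι → ℝ)
    (h0 : ∀ π, G 0 π = 0) (hG : ∀ j π, G j π ≤ G (j + 1) π) (ρ : ι) (N : ℕ) :
    ∑ j ∈ Finset.range N, ∑ π, Real.exp (-η * G j π) / (∑ π', Real.exp (-η * G j π')) *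
        (G (j + 1) π - G j π) ≤
      G N ρ + Real.log (Fintype.card ι) / η +
        η * ∑ j ∈ Finset.range N, ∑ π, Real.exp (-η * G j π) / (∑ π', Real.exp (-η * G j π')) *
          (G (j + 1) π - G j π) ^ 2 := by
  have : Nonempty ι := ⟨ρ⟩
  set Z : ℕ → ℝ := fun j => ∑ π, Real.exp (-η * G j π) with hZ
  have hZpos : ∀ j, 0 < Z j := fun j =>
    Finset.sum_pos (fun _ _ => Real.exp_pos _) Finset.univ_nonempty
  set a : ℕ → ℝ := fun j => ∑ π, Real.exp (-η * G j π) / Z j * (G (j + 1) π - G j π) with ha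
  set b : ℕ → ℝ := fun j => ∑ π, Real.exp (-η * G j π) / Z j * (G (j + 1) π - G j π) ^ 2 with hb
  -- `1 / (1 + x) ≤ 1 - x + x^2` because `(1 + x)(1 - x + x^2) = 1 + x^3`. No upper bound on `x` is
  -- needed, which matters as the estimators are unbounded.
  have hexp : ∀ x : ℝ, 0 ≤ x → Real.exp (-x) ≤ 1 - x + x ^ 2 := by
    intro x hx
    have h1 : Real.exp (-x) ≤ (1 + x)⁻¹ := by
      rw [Real.exp_neg]
      exact inv_anti₀ (by linarith) (by linarith [Real.add_one_le_exp x])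
    refine h1.trans ?_
    rw [inv_le_iff_one_le_mul₀ (by linarith)]
    nlinarith [pow_nonneg hx 3]
  have hstep : ∀ j, Z (j + 1) ≤ Z j * Real.exp (-η * a j + η ^ 2 * b j) := by
    intro j
    have hZj := (hZpos j).ne'
    calc Z (j + 1) = ∑ π, Real.exp (-η * G j π) * Real.exp (-(η * (G (j + 1) π - G j π))) := by
          refine Finset.sum_congr rfl fun π _ => ?_
          rw [← Real.exp_add]
          congr 1
          ring
      _ ≤ ∑ π, Real.exp (-η * G j π) *
            (1 - η * (G (j + 1) π - G j π) + (η * (G (j + 1) π - G j π)) ^ 2) := by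
          refine Finset.sum_le_sum fun π _ => mul_le_mul_of_nonneg_left (hexp _ ?_)
            (Real.exp_pos _).le
          exact mul_nonneg hη.le (sub_nonneg.2 (hG j π))
      _ = Z j * ((-η * a j + η ^ 2 * b j) + 1) := by
          have h1 : Z j * a j = ∑ π, Real.exp (-η * G j π) * (G (j + 1) π - G j π) := by
            rw [ha, Finset.mul_sum]
            exact Finset.sum_congr rfl fun π _ => by field_simp
          have h2 : Z j * b j = ∑ π, Real.exp (-η * G j π) * (G (j + 1) π - G j π) ^ 2 := by
            rw [hb, Finset.mul_sum]
            exact Finset.sum_congr rfl fun π _ => by field_simp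
          calc _ = Z j - η * ∑ π, Real.exp (-η * G j π) * (G (j + 1) π - G j π) +
                η ^ 2 * ∑ π, Real.exp (-η * G j π) * (G (j + 1) π - G j π) ^ 2 := by
                rw [Finset.mul_sum, Finset.mul_sum, ← Finset.sum_sub_distrib,
                  ← Finset.sum_add_distrib]
                exact Finset.sum_congr rfl fun π _ => by ring
            _ = _ := by rw [← h1, ← h2]; ring
      _ ≤ _ := mul_le_mul_of_nonneg_left (Real.add_one_le_exp _) (hZpos j).le
  have hprod : ∀ n, Z n ≤ Fintype.card ι * Real.exp (-η * ∑ j ∈ Finset.range n, a j +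
      η ^ 2 * ∑ j ∈ Finset.range n, b j) := by
    intro n
    induction n with
    | zero => simp [hZ, h0]
    | succ n ih =>
      refine (hstep n).trans ((mul_le_mul_of_nonneg_right ih (Real.exp_pos _).le).trans
        (le_of_eq ?_))
      rw [mul_assoc, ← Real.exp_add, Finset.sum_range_succ, Finset.sum_range_succ]
      congr 2
      ring
  have hlow : Real.exp (-η * G N ρ) ≤ Z N :=
    Finset.single_le_sum (f := fun π => Real.exp (-η * G N π)) (fun _ _ => (Real.exp_pos _).le)
      (Finset.mem_univ ρ)
  have hlog := Real.log_le_log (Real.exp_pos _) (hlow.trans (hprod N))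
  rw [Real.log_exp, Real.log_mul (by simp [Fintype.card_ne_zero]) (Real.exp_pos _).ne',
    Real.log_exp] at hlog
  change ∑ j ∈ Finset.range N, a j ≤ G N ρ + _ + η * ∑ j ∈ Finset.range N, b j
  have hcan : η * (Real.log (Fintype.card ι) / η) = Real.log (Fintype.card ι) := by
    field_simp
  refine le_of_mul_le_mul_left ?_ hη
  rw [mul_add, mul_add, hcan]
  nlinarith

theorem sum_range_mul {β : Type*} [AddCommMonoid β] (f : ℕ → β) (J H : ℕ) :
    ∑ t ∈ Finset.range (J * H), f t =
      ∑ j ∈ Finset.range J, ∑ i ∈ Finset.range H, f (j * H + i) := by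
  induction J with
  | zero => simp
  | succ J ih => rw [Nat.succ_mul, Finset.sum_range_add, ih, Finset.sum_range_succ]

section Pathwise

variable {S A : Type*} [Fintype S] [DecidableEq S] [Fintype A] [DecidableEq A] [Nonempty A]
  (M : AMDP S A) {η : ℝ}

/-- The Hedge distribution of the epoch that contains slot `t`. -/
def epochLaw (η : ℝ) (H : ℕ) (est : ℕ → S → A → ℝ) (t : ℕ) : PMF (Policy S A) :=
  M.hedge η est (t / H * H)

/-- `⟨q^t, ℓ̂^t⟩` for the mixture `q^t` of the occupancy measures in slot `t`. -/
def hedgeLoss (η : ℝ) (H : ℕ) (est : ℕ → S → A → ℝ) (t : ℕ) : ℝ :=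
  ∑ π : Policy S A, (M.epochLaw η H est t π).toReal * M.pairing π t (est t)

/-- Each epoch is one round, since the law is constant on it; Cauchy–Schwarz over its `H` slots
turns the squared epoch loss into `H` times the sum of squares. -/
theorem sum_hedgeLoss_le (hη : 0 < η) {H : ℕ} (J : ℕ) (est : ℕ → S → A → ℝ)
    (hest : ∀ t s a, 0 ≤ est t s a) (ρ : Policy S A) :
    ∑ t ∈ Finset.range (J * H), M.hedgeLoss η H est t ≤
      ∑ t ∈ Finset.range (J * H), M.pairing ρ t (est t) +
        Real.log (Fintype.card (Policy S A)) / η +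
        η * H * ∑ t ∈ Finset.range (J * H), ∑ π : Policy S A,
          (M.epochLaw η H est t π).toReal * M.pairing π t (est t) ^ 2 := by
  set G : ℕ → Policy S A → ℝ := fun j π => ∑ t ∈ Finset.range (j * H), M.pairing π t (est t)
    with hGdef
  have hdiff : ∀ j π, G (j + 1) π - G j π =
      ∑ i ∈ Finset.range H, M.pairing π (j * H + i) (est (j * H + i)) := by
    intro j π
    simp only [hGdef, Nat.succ_mul, Finset.sum_range_add, add_sub_cancel_left]
  have hreg := exp_weights_regret hη G (fun π => by simp [hGdef])
    (fun j π => by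
      rw [← sub_nonneg, hdiff]
      exact Finset.sum_nonneg fun i _ => M.pairing_nonneg _ _ (hest _)) ρ J
  have hlaw : ∀ j, ∀ i ∈ Finset.range H, ∀ π, (M.epochLaw η H est (j * H + i) π).toReal =
      Real.exp (-η * G j π) / ∑ π', Real.exp (-η * G j π') := by
    intro j i hi π
    have hi' := Finset.mem_range.1 hi
    rw [epochLaw, hedge_toReal, mul_comm j, Nat.mul_add_div (by omega), Nat.div_eq_of_lt hi']
    rfl
  have hlhs : ∑ t ∈ Finset.range (J * H), M.hedgeLoss η H est t =
      ∑ j ∈ Finset.range J, ∑ π, Real.exp (-η * G j π) / (∑ π', Real.exp (-η * G j π')) *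
        (G (j + 1) π - G j π) := by
    rw [sum_range_mul]
    refine Finset.sum_congr rfl fun j _ => ?_
    simp only [hdiff, hedgeLoss, Finset.mul_sum]
    rw [Finset.sum_comm]
    refine Finset.sum_congr rfl fun π _ => Finset.sum_congr rfl fun i hi => ?_
    rw [hlaw j i hi]
  rw [hlhs]
  refine hreg.trans (add_le_add le_rfl ?_)
  rw [mul_assoc]
  refine mul_le_mul_of_nonneg_left ?_ hη.le
  rw [sum_range_mul, Finset.mul_sum]
  refine Finset.sum_le_sum fun j _ => ?_
  rw [Finset.sum_comm, Finset.mul_sum]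
  refine Finset.sum_le_sum fun π _ => ?_
  have hsum : ∑ i ∈ Finset.range H, (M.epochLaw η H est (j * H + i) π).toReal *
        M.pairing π (j * H + i) (est (j * H + i)) ^ 2 =
      Real.exp (-η * G j π) / (∑ π', Real.exp (-η * G j π')) *
        ∑ i ∈ Finset.range H, M.pairing π (j * H + i) (est (j * H + i)) ^ 2 := by
    rw [Finset.mul_sum]
    exact Finset.sum_congr rfl fun i hi => by rw [hlaw j i hi π]
  rw [hsum, mul_left_comm, hdiff]
  refine mul_le_mul_of_nonneg_left ?_ (div_nonneg (Real.exp_pos _).le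
    (Finset.sum_nonneg fun _ _ => (Real.exp_pos _).le))
  simpa using sq_sum_le_card_mul_sum_sq (s := Finset.range H)
    (f := fun i => M.pairing π (j * H + i) (est (j * H + i)))

end Pathwise

/-! ### Expected switching loss and expected estimators along a run -/

section Potentials

variable {S A : Type*} [Fintype S] [DecidableEq S] {M : AMDP S A} {sStar : S}

/-- Bound on the expected number of steps of one run of the switching procedure. -/
def SwitchPlan.switchCost (W : M.SwitchPlan sStar) : ℝ≥0∞ := (M.diameter + W.len) / W.minProb

/-- The fixed-point equation of the loop: reach the parking state, make an attempt, and start over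
with probability `1 - p*`. -/
theorem SwitchPlan.switchCost_eq (W : M.SwitchPlan sStar) (hD : M.diameter < ⊤) :
    M.diameter + (W.len + (1 - W.minProb) * W.switchCost) = W.switchCost := by
  have h : W.minProb * W.switchCost = M.diameter + W.len :=
    ENNReal.mul_div_cancel (W.minProb_ne_zero hD) W.minProb_ne_top
  rw [← add_assoc, ← h, ← add_mul, add_tsub_cancel_of_le W.minProb_le_one, one_mul]

theorem SwitchPlan.switchCost_le (W : M.SwitchPlan sStar) :
    W.switchCost ≤ 12 * M.diameter ^ 2 := by
  have h1 : W.minProb⁻¹ ≤ 4 * M.diameter := by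
    rw [ENNReal.inv_le_iff_inv_le]
    exact W.minProb_ge
  rw [switchCost, div_eq_mul_inv]
  calc _ ≤ (M.diameter + 2 * M.diameter) * (4 * M.diameter) := by
        gcongr
        exact W.len_le
    _ = _ := by ring

variable {W : M.SwitchPlan sStar} {η : ℝ} {H n : ℕ} {c : Config S A}

/-- A policy is played only in slots of its own epoch: once the next epoch is due, a returned
procedure is followed by a new switch instead of play. -/
theorem Ready.div_eq (hc : Ready W H n c) (hp : c.phase = .play) : n / H = c.begun - 1 := by
  have h1 := hc.lt_begun hp
  have h2 : c.begun - 1 + 1 = c.begun := by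
    have : c.begun ≠ 0 := fun h => by simp [h] at h1
    omega
  exact Nat.div_eq_of_lt_le hc.begun_le (by rwa [h2])

theorem action_of_play (hp : c.phase = .play) : action W c = c.policy c.state := by
  rcases c with ⟨s, b, π, φ, est, tot⟩
  obtain rfl : φ = .play := hp
  rfl

variable [Fintype A] [DecidableEq A] [Nonempty A]

theorem Ready.nextEst_apply (hc : Ready W H n c) (hp : c.phase = .play) :
    nextEst (M := M) η H n c n = lossEstimate (M := M) (M.epochLaw η H c.est n) n c.state
      (c.policy c.state) (M.loss n c.state (c.policy c.state)) := by
  rw [nextEst_of_play hp, Function.update_self, epochLaw, hc.div_eq hp]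

theorem epochLaw_nextEst (t : ℕ) (h : t / H * H ≤ n) :
    M.epochLaw η H (nextEst (M := M) η H n c) t = M.epochLaw η H c.est t :=
  M.hedge_congr fun i hi => nextEst_apply_of_ne (by omega)

/-- The mixture cancels against the denominator of the estimator. It is positive because Hedge gives
weight to every policy and the current state has positive probability under the one played. -/
theorem Ready.hedgeLoss_nextEst_of_play (hc : Ready W H n c) (hp : c.phase = .play) :
    M.hedgeLoss η H (nextEst (M := M) η H n c) n = M.loss n c.state (action W c) := by
  rw [action_of_play hp, hedgeLoss, epochLaw_nextEst _ (Nat.div_mul_le_self _ _),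
    hc.nextEst_apply hp]
  simp only [pairing_lossEstimate, ← mul_assoc, ← Finset.sum_mul]
  refine mul_div_cancel₀ _ (ne_of_gt ?_)
  refine Finset.sum_pos' (fun π _ => mul_nonneg ENNReal.toReal_nonneg (occupancy_nonneg _ _ _ _))
    ⟨c.policy, Finset.mem_univ _, mul_pos (M.hedge_toReal_pos _ _ _) ?_⟩
  rw [occupancy, if_pos rfl]
  exact ENNReal.toReal_pos (hc.play_ne_zero hp) (PMF.apply_ne_top _ _)

theorem Ready.hedgeLoss_nextEst_of_ne_play (hc : Ready W H n c) (hp : c.phase ≠ .play) :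
    M.hedgeLoss η H (nextEst (M := M) η H n c) n = 0 := by
  rw [nextEst_of_ne_play hp, hedgeLoss, hc.est_eq_zero n le_rfl]
  simp [pairing_zero]

/-- The loss suffered in the slots of the switching procedure. -/
def switchLoss (M : AMDP S A) (η : ℝ) (H n : ℕ) (c : Config S A) : ℝ :=
  c.total - ∑ t ∈ Finset.range n, M.hedgeLoss η H c.est t

theorem switchLoss_advance (s' : S) :
    switchLoss M η H (n + 1) (advance W η H n c s') = switchLoss M η H n c +
      (M.loss n c.state (action W c) - M.hedgeLoss η H (nextEst (M := M) η H n c) n) := by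
  simp only [switchLoss, advance, Finset.sum_range_succ]
  have : ∑ t ∈ Finset.range n, M.hedgeLoss η H (nextEst (M := M) η H n c) t =
      ∑ t ∈ Finset.range n, M.hedgeLoss η H c.est t := by
    refine Finset.sum_congr rfl fun t ht => ?_
    have ht' := Finset.mem_range.1 ht
    rw [hedgeLoss, hedgeLoss, epochLaw_nextEst _ ((Nat.div_mul_le_self _ _).trans ht'.le),
      nextEst_apply_of_ne ht'.ne]
  rw [this]
  ring

/-- The potential is the switching loss so far, plus a budget `switchCost` for each epoch not yet
begun, plus the expected remaining length of the current switch. -/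
theorem mean_switchLoss_le [Nontrivial S] (hD : M.diameter < ⊤) {J N : ℕ} (hN : N ≤ J * H) :
    mean (run W η H N) (fun c => ENNReal.ofReal (switchLoss M η H N c)) ≤ J * W.switchCost := by
  set R := W.switchCost
  set K := W.len + (1 - W.minProb) * R
  have hK : M.diameter + K = R := W.switchCost_eq hD
  set z : S → S → ℝ≥0∞ := fun o s => M.expHitTime (W.toStar o) sStar s + K with hz
  have hzz : ∀ s, z s s ≤ R := by
    intro s
    rw [← hK]
    refine add_le_add ?_ le_rfl
    by_cases hs : s = sStar
    · simp [hs, expHitTime_self]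
    · exact W.toStar_spec s hs
  set B : ℕ → Config S A → ℝ≥0∞ := fun n c =>
    ENNReal.ofReal (switchLoss M η H n c) + (J - c.begun : ℕ) * R with hB
  set V : ℕ → Config S A → ℝ≥0∞ := fun n c =>
    B n c + switchValue W 1 0 R z n c.phase c.state with hV
  have hrun : mean (run W η H N) (V N) ≤ V 0 (initConfig W) := by
    refine mean_run_le (W.len_pos hD) fun n hn c hc => ?_
    refine mean_slot_le (W.len_pos hD) (V := V n) hc ?_ ?_ ?_ ?_
    · intro c _
      exact mean_finishAttempt_le (e := B n c) (fun φ => rfl) hzz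
    · intro c _
      rcases c with ⟨s, b, π, φ, est, tot⟩
      cases φ with
      | moving o => exact (mean_pure _ _).le
      | aiming g k => exact (mean_pure _ _).le
      | play =>
        simp only [beginEpoch]
        split_ifs with hb
        -- An epoch begins only in a slot below `N ≤ J * H`, so one unit of the budget is still
        -- available.
        · have hbJ : b < J := lt_of_mul_lt_mul_right (hb.trans_lt (hn.trans_le hN)) (Nat.zero_le H)
          rw [mean_map]
          refine (mean_mono fun π' => ?_).trans (mean_const _ _).le
          simp only [hV, hB, switchValue, Pi.zero_apply, add_zero, add_assoc]
          refine add_le_add le_rfl ?_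
          rw [show J - b = (J - (b + 1)) + 1 by omega]
          push_cast
          rw [add_mul, one_mul]
          exact add_le_add le_rfl (hzz s)
        · exact (mean_pure _ _).le
    · intro c _
      refine mean_beginAttempt_le (e := B n c) hD (fun φ => rfl) fun o => ?_
      simp [hz, expHitTime_self, K, mean]
    · intro c hc
      by_cases hp : c.phase = .play
      · refine (mean_mono fun s' => ?_).trans (mean_const _ _).le
        simp only [hV, hB, switchLoss_advance, hc.hedgeLoss_nextEst_of_play hp, sub_self, add_zero]
        refine add_le_add le_rfl (le_of_eq_of_le ?_ bot_le)
        simp [advance, hp, nextPhase, switchValue]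
      · have hstep := switchValue_step (W := W) (κ := 1) (x := 0) (y := R) (z := z) (n := n)
          (fun o s hs => by
            simp only [hz, mean_add, mean_const, ← add_assoc]
            refine add_le_add ?_ le_rfl
            rw [mean, tsum_fintype]
            exact M.one_add_sum_expHitTime_le hs) c hp hc.state_ne hc.steps_lt
        calc _ ≤ mean (M.trans c.state (action W c)) (fun s' => B n c + (1 +
              switchValue W 1 0 R z (n + 1) (nextPhase c.phase) s')) := by
              refine mean_mono fun s' => ?_
              simp only [hV, hB, switchLoss_advance, hc.hedgeLoss_nextEst_of_ne_play hp, sub_zero]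
              calc _ ≤ (ENNReal.ofReal (switchLoss M η H n c) + 1) + (J - c.begun : ℕ) * R +
                    switchValue W 1 0 R z (n + 1) (nextPhase c.phase) s' := by
                    refine add_le_add (add_le_add (ENNReal.ofReal_add_le.trans
                      (add_le_add le_rfl ?_)) le_rfl) le_rfl
                    exact ENNReal.ofReal_le_one.2 (M.loss_le_one _ _ _)
                _ = _ := by ring
          _ ≤ _ := by
              rw [mean_add, mean_const, mean_add, mean_const]
              exact add_le_add le_rfl hstep
  refine (mean_mono fun c => ?_).trans (hrun.trans (le_of_eq ?_))
  · exact le_self_add.trans le_self_add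
  · simp [hV, hB, switchLoss, initConfig, switchValue]

/-- If a function of the Hedge distribution and of the estimator of slot `t` is at most `B` on
average under the law that the mixture of the policies has in slot `t`, then it is at most `B` on
average in the run of the algorithm. -/
theorem mean_est_le [Nontrivial S] (hD : M.diameter < ⊤) (hH : 0 < H)
    {F : PMF (Policy S A) → (S → A → ℝ) → ℝ≥0∞} (hF0 : ∀ p, F p 0 = 0) {t N : ℕ} (ht : t < N)
    {B : ℝ≥0∞} (hFB : ∀ p, mean p (fun π => mean (M.stateLaw π t) fun s =>
      F p (lossEstimate (M := M) p t s (π s) (M.loss t s (π s)))) ≤ B) :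
    mean (run W η H N) (fun c => F (M.epochLaw η H c.est t) (c.est t)) ≤ B := by
  set φ : PMF (Policy S A) → Policy S A → S → ℝ≥0∞ := fun p π s =>
    F p (lossEstimate (M := M) p t s (π s) (M.loss t s (π s))) with hφ
  set m : PMF (Policy S A) → Policy S A → ℝ≥0∞ := fun p π => mean (M.stateLaw π t) (φ p π) with hm
  -- If the procedure returns after slot `t`, the estimator of slot `t` stays zero, hence the value
  -- `0`.
  set x : PMF (Policy S A) → Policy S A → ℕ → S → ℝ≥0∞ := fun p π n s =>
    if n ≤ t then mean (M.lawAfter (fun _ => π) s (t - n)) (φ p π) else 0 with hx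
  set U : PMF (Policy S A) → Policy S A → ℕ → Phase S → S → ℝ≥0∞ := fun p π =>
    switchValue W 0 (x p π) (m p π) (fun _ _ => m p π) with hU
  -- Epochs count from `0`, so `c.begun ≤ t / H` means that the epoch of slot `t` has not begun;
  -- then `B` is a bound whatever Hedge law it will use.
  set V : ℕ → Config S A → ℝ≥0∞ := fun n c =>
    if n ≤ t then
      if c.begun ≤ t / H then B else U (M.epochLaw η H c.est t) c.policy n c.phase c.state
    else F (M.epochLaw η H c.est t) (c.est t) with hV
  have hVN : V N = fun c => F (M.epochLaw η H c.est t) (c.est t) := by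
    funext c
    simp only [hV, if_neg (not_le.2 ht)]
  rw [← hVN]
  refine (mean_run_le (W.len_pos hD) (V := V) fun n hn c hc => ?_).trans (le_of_eq ?_)
  swap
  · simp [hV, initConfig]
  refine mean_slot_le (W.len_pos hD) (V := V n) hc ?_ ?_ ?_ ?_
  · intro c _
    by_cases h : n ≤ t ∧ ¬ c.begun ≤ t / H
    · refine mean_finishAttempt_le (n := n) (e := 0) (κ := 0)
        (x := x (M.epochLaw η H c.est t) c.policy)
        (y := m (M.epochLaw η H c.est t) c.policy)
        (z := fun _ _ => m (M.epochLaw η H c.est t) c.policy) (fun ψ => ?_) fun _ => le_rfl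
      simp only [hV, if_pos h.1, if_neg h.2, zero_add, hU]
    · refine mean_finishAttempt_of_const fun ψ => ?_
      simp only [hV]
      split_ifs <;> first | rfl | tauto
  · intro c _
    rcases c with ⟨s, b, π, ψ, est, tot⟩
    cases ψ with
    | moving o => exact (mean_pure _ _).le
    | aiming g k => exact (mean_pure _ _).le
    | play =>
      simp only [beginEpoch]
      split_ifs with hb
      · rw [mean_map]
        simp only [hV]
        by_cases hnt : n ≤ t
        · have h2 : b ≤ t / H := (Nat.le_div_iff_mul_le hH).2 (hb.trans hnt)
          simp only [if_pos hnt, if_pos h2]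
          by_cases h1 : b + 1 ≤ t / H
          · simp only [if_pos h1]
            exact (mean_const _ _).le
          · have hbt : t / H = b := by omega
            have : M.epochLaw η H est t = M.hedge η est (b * H) := by rw [epochLaw, hbt]
            simp only [if_neg h1, hU, switchValue]
            rw [this]
            exact hFB _
        · simp only [if_neg hnt]
          exact (mean_const _ _).le
      · exact (mean_pure _ _).le
  · intro c _
    by_cases h : n ≤ t ∧ ¬ c.begun ≤ t / H
    · refine mean_beginAttempt_le (n := n) (e := 0) (κ := 0)
        (x := x (M.epochLaw η H c.est t) c.policy)
        (y := m (M.epochLaw η H c.est t) c.policy)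
        (z := fun _ _ => m (M.epochLaw η H c.est t) c.policy) hD (fun ψ => ?_) fun _ => ?_
      · simp only [hV, if_pos h.1, if_neg h.2, zero_add, hU]
      -- By Chapman–Kolmogorov a return at the end of this attempt is worth exactly the average
      -- under the state law of slot `t`, or nothing if it comes too late.
      · have hle : mean (M.stateLaw c.policy (n + W.len))
            (x (M.epochLaw η H c.est t) c.policy (n + W.len)) ≤
              m (M.epochLaw η H c.est t) c.policy := by
          simp only [hx, hm]
          split_ifs with hl
          · rw [← mean_bind, ← stateLaw_add, Nat.add_sub_cancel' hl]
          · simp [mean]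
        rw [zero_mul, zero_add]
        calc _ ≤ W.minProb * m (M.epochLaw η H c.est t) c.policy +
              (1 - W.minProb) * m (M.epochLaw η H c.est t) c.policy := by gcongr
          _ = _ := by rw [← add_mul, add_tsub_cancel_of_le W.minProb_le_one, one_mul]
    · refine mean_beginAttempt_of_const hD fun ψ => ?_
      simp only [hV]
      split_ifs <;> first | rfl | tauto
  · intro c hc
    rcases lt_trichotomy n t with hnt | rfl | hnt
    · have h1 : n + 1 ≤ t := hnt
      simp only [hV, if_pos h1, if_pos hnt.le]
      by_cases hb : c.begun ≤ t / H
      · rw [if_pos hb]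
        exact (mean_mono fun s' => (if_pos hb).le).trans (mean_const _ _).le
      · have hlaw : M.epochLaw η H (nextEst (M := M) η H n c) t = M.epochLaw η H c.est t :=
          epochLaw_nextEst t ((Nat.mul_le_mul_right H (by omega)).trans hc.begun_le)
        simp only [advance, if_neg hb, hlaw]
        by_cases hp : c.phase = .play
        · simp only [hp, nextPhase, hU, switchValue, hx, if_pos h1, if_pos hnt.le]
          rw [action_of_play hp, ← mean_bind, show t - n = (t - (n + 1)) + 1 by omega,
            lawAfter_succ_left]
        · have := switchValue_step (W := W) (κ := 0) (x := x (M.epochLaw η H c.est t) c.policy)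
            (y := m (M.epochLaw η H c.est t) c.policy)
            (z := fun _ _ => m (M.epochLaw η H c.est t) c.policy) (n := n)
            (fun _ _ _ => by rw [zero_add, mean_const]) c hp hc.state_ne hc.steps_lt
          rwa [zero_add] at this
    · simp only [hV, if_neg (Nat.not_succ_le_self n), le_refl, if_true, advance, mean_const]
      by_cases hp : c.phase = .play
      · have hb : ¬ c.begun ≤ n / H := by
          have h1 := hc.lt_begun hp
          have h2 : c.begun ≠ 0 := fun h => by simp [h] at h1
          have := hc.div_eq hp
          omega
        rw [epochLaw_nextEst _ (Nat.div_mul_le_self _ _), hc.nextEst_apply hp, if_neg hb]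
        simp [hU, hp, switchValue, hx, lawAfter, mean_pure, hφ]
      · rw [nextEst_of_ne_play hp, hc.est_eq_zero n le_rfl, hF0]
        exact bot_le
    · simp only [hV, if_neg (not_le.2 hnt), if_neg (not_le.2 (hnt.trans n.lt_succ_self)), advance,
        mean_const, nextEst_apply_of_ne hnt.ne]
      rw [epochLaw_nextEst _ ((Nat.div_mul_le_self _ _).trans hnt.le)]

end Potentials

/-! ### Assembly of the regret bound -/

theorem expect_eq_toReal_mean {α : Type*} {p : PMF α} {f : α → ℝ}
    (hf : ∀ x ∈ p.support, 0 ≤ f x) :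
    p.expect f = (mean p fun x => ENNReal.ofReal (f x)).toReal := by
  rw [mean, ENNReal.tsum_toReal_eq fun x =>
    ENNReal.mul_ne_top (PMF.apply_ne_top _ _) ENNReal.ofReal_ne_top]
  refine tsum_congr fun x => ?_
  rw [ENNReal.toReal_mul]
  by_cases hx : p x = 0
  · simp [hx]
  · rw [ENNReal.toReal_ofReal (hf x ((PMF.mem_support_iff _ _).2 hx))]

theorem policyLoss_nonneg {S A : Type*} [Fintype S] {M : AMDP S A} (π : Policy S A) :
    0 ≤ M.policyLoss π :=
  Finset.sum_nonneg fun _ _ => Finset.sum_nonneg fun _ _ =>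
    mul_nonneg ENNReal.toReal_nonneg (M.loss_nonneg _ _ _)

section Regret

variable {S A : Type*} [Fintype S] [DecidableEq S] [Nontrivial S] [Fintype A] [DecidableEq A]
  [Nonempty A] {M : AMDP S A} {sStar : S} {W : M.SwitchPlan sStar} {η : ℝ} {H : ℕ}

/-- The last epoch may extend beyond the horizon; the estimators there are still zero. -/
theorem sum_mean_est_le (hD : M.diameter < ⊤)
    {F : ℕ → PMF (Policy S A) → (S → A → ℝ) → ℝ≥0∞} (hF0 : ∀ t p, F t p 0 = 0) {N L : ℕ}
    (hN : N ≤ L * H) {B : ℕ → ℝ≥0∞}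
    (hFB : ∀ t p, mean p (fun π => mean (M.stateLaw π t) fun s =>
      F t p (lossEstimate (M := M) p t s (π s) (M.loss t s (π s)))) ≤ B t) :
    mean (run W η H N)
        (fun c => ∑ t ∈ Finset.range (L * H), F t (M.epochLaw η H c.est t) (c.est t)) ≤
      ∑ t ∈ Finset.range N, B t := by
  rw [mean_sum, ← Nat.add_sub_cancel' hN, Finset.sum_range_add]
  refine (add_le_add (Finset.sum_le_sum fun t ht => ?_) (Finset.sum_nonpos fun i _ => ?_)).trans
    (add_zero _).le
  · have ht' := Finset.mem_range.1 ht
    have hH : 0 < H := Nat.pos_of_ne_zero fun h => by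
      rw [h, mul_zero] at hN
      omega
    exact mean_est_le hD hH (hF0 t) ht' (hFB t)
  · refine (mean_mono_support fun c hc => ?_).trans (mean_const _ 0).le
    rw [(reachable_run (W.len_pos hD) hc).est_eq_zero _ (by omega), hF0]

theorem mean_total_le (hD : M.diameter < ⊤) (hη : 0 < η) {J : ℕ} (hJ : M.horizon ≤ J * H)
    (ρ : Policy S A) :
    mean (run W η H M.horizon) (fun c => ENNReal.ofReal c.total) ≤
      ENNReal.ofReal (12 * J * M.diameter.toReal ^ 2 + M.policyLoss ρ +
        Fintype.card S * Real.log (Fintype.card A) / η +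
        η * H * (M.horizon * (Fintype.card S * Fintype.card A))) := by
  have hlog0 : 0 ≤ Real.log (Fintype.card A) :=
    Real.log_nonneg (by exact_mod_cast Fintype.card_pos)
  have hlog : Real.log (Fintype.card (Policy S A)) = Fintype.card S * Real.log (Fintype.card A) := by
    simp [Policy]
  have hsw : (J : ℝ≥0∞) * W.switchCost ≤ ENNReal.ofReal (12 * J * M.diameter.toReal ^ 2) := by
    refine (mul_le_mul_right W.switchCost_le _).trans (le_of_eq ?_)
    rw [ENNReal.ofReal_mul (by positivity), ENNReal.ofReal_pow ENNReal.toReal_nonneg,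
      ENNReal.ofReal_toReal hD.ne, ENNReal.ofReal_mul (by norm_num), ENNReal.ofReal_natCast,
      ENNReal.ofReal_ofNat]
    ring
  -- The bound is pathwise; expectations are taken only afterwards, of each nonnegative part
  -- separately.
  have hpt : ∀ c ∈ (run W η H M.horizon).support, ENNReal.ofReal c.total ≤
      (ENNReal.ofReal (switchLoss M η H M.horizon c) +
        ∑ t ∈ Finset.range (J * H), ENNReal.ofReal (M.pairing ρ t (c.est t))) +
      (ENNReal.ofReal (Fintype.card S * Real.log (Fintype.card A) / η) +
        ENNReal.ofReal (η * H) * ∑ t ∈ Finset.range (J * H), ENNReal.ofReal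
          (∑ π : Policy S A, (M.epochLaw η H c.est t π).toReal * M.pairing π t (c.est t) ^ 2)) := by
    intro c hc
    have hr := reachable_run (W.len_pos hD) hc
    have hpos1 : ∀ t, 0 ≤ M.pairing ρ t (c.est t) := fun t => M.pairing_nonneg _ _ (hr.est_nonneg t)
    have hpos2 : ∀ t, 0 ≤ ∑ π : Policy S A,
        (M.epochLaw η H c.est t π).toReal * M.pairing π t (c.est t) ^ 2 := fun t =>
      Finset.sum_nonneg fun π _ => mul_nonneg ENNReal.toReal_nonneg (sq_nonneg _)
    have h1 : c.total = switchLoss M η H M.horizon c +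
        ∑ t ∈ Finset.range M.horizon, M.hedgeLoss η H c.est t := by
      rw [switchLoss]; ring
    have h2 : ∑ t ∈ Finset.range M.horizon, M.hedgeLoss η H c.est t ≤
        ∑ t ∈ Finset.range (J * H), M.hedgeLoss η H c.est t :=
      Finset.sum_le_sum_of_subset_of_nonneg (Finset.range_subset_range.2 hJ) fun t _ _ =>
        Finset.sum_nonneg fun π _ => mul_nonneg ENNReal.toReal_nonneg
          (M.pairing_nonneg _ _ (hr.est_nonneg t))
    have h3 := M.sum_hedgeLoss_le (η := η) hη (H := H) J c.est hr.est_nonneg ρ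
    rw [hlog] at h3
    rw [← ENNReal.ofReal_sum_of_nonneg fun t _ => hpos1 t,
      ← ENNReal.ofReal_sum_of_nonneg fun t _ => hpos2 t, ← ENNReal.ofReal_mul (by positivity),
      ← ENNReal.ofReal_add (by positivity)
        (mul_nonneg (by positivity) (Finset.sum_nonneg fun t _ => hpos2 t)), add_assoc,
      ← ENNReal.ofReal_add (Finset.sum_nonneg fun t _ => hpos1 t) (add_nonneg (by positivity)
        (mul_nonneg (by positivity) (Finset.sum_nonneg fun t _ => hpos2 t)))]
    refine le_trans (ENNReal.ofReal_le_ofReal ?_) ENNReal.ofReal_add_le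
    linarith
  refine (mean_mono_support hpt).trans ?_
  rw [mean_add, mean_add, mean_add, mean_const, mean_const_mul]
  have h1 := (mean_switchLoss_le (W := W) (η := η) hD hJ).trans hsw
  have h2 := sum_mean_est_le (W := W) (η := η) hD
    (F := fun t _ f => ENNReal.ofReal (M.pairing ρ t f)) (fun t _ => by simp [pairing_zero]) hJ
    (fun t p => M.mean_pairing_lossEstimate_le p ρ t)
  have h3 := sum_mean_est_le (W := W) (η := η) hD
    (F := fun t p f => ENNReal.ofReal (∑ π : Policy S A, (p π).toReal * M.pairing π t f ^ 2))
    (fun t _ => by simp [pairing_zero]) hJ (fun t p => M.mean_sq_pairing_lossEstimate_le p t)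
  have hposl : ∀ t, 0 ≤ ∑ s, (M.stateLaw ρ t s).toReal * M.loss t s (ρ s) := fun t =>
    Finset.sum_nonneg fun s _ => mul_nonneg ENNReal.toReal_nonneg (M.loss_nonneg _ _ _)
  rw [← ENNReal.ofReal_sum_of_nonneg fun t _ => hposl t] at h2
  rw [← ENNReal.ofReal_sum_of_nonneg fun t _ => by positivity, Finset.sum_const, Finset.card_range,
    nsmul_eq_mul] at h3
  have hpl : 0 ≤ M.policyLoss ρ := Finset.sum_nonneg fun t _ => hposl t
  rw [ENNReal.ofReal_add (by positivity) (by positivity),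
    ENNReal.ofReal_add (by positivity) (by positivity),
    ENNReal.ofReal_add (by positivity) (by positivity), add_assoc (_ + _),
    ENNReal.ofReal_mul (p := η * H) (by positivity)]
  exact add_le_add (add_le_add h1 h2) (add_le_add le_rfl (mul_le_mul_right h3 _))

theorem hedgeRegret_le_horizon (hD : M.diameter < ⊤) (J : ℕ) :
    hedgeRegret W η J ≤ M.horizon := by
  rw [hedgeRegret, expect_eq_toReal_mean fun c hc =>
    (reachable_run (W.len_pos hD) hc).total_nonneg, sub_le_iff_le_add]
  have h1 : mean (run W η (epochLength M.horizon J) M.horizon)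
      (fun c => ENNReal.ofReal c.total) ≤ ENNReal.ofReal M.horizon :=
    (mean_mono_support fun c hc =>
      ENNReal.ofReal_le_ofReal (reachable_run (W.len_pos hD) hc).total_le).trans (mean_const _ _).le
  have h2 := ENNReal.toReal_le_of_le_ofReal (Nat.cast_nonneg _) h1
  have h3 : 0 ≤ ⨅ π : Policy S A, M.policyLoss π := Real.iInf_nonneg fun π => policyLoss_nonneg π
  linarith

theorem hedgeRegret_le (hD : M.diameter < ⊤) (hη : 0 < η) {J : ℕ} (hJ : 0 < J) :
    hedgeRegret W η J ≤ 12 * J * M.diameter.toReal ^ 2 +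
      Fintype.card S * Real.log (Fintype.card A) / η +
      η * epochLength M.horizon J * (M.horizon * (Fintype.card S * Fintype.card A)) := by
  obtain ⟨ρ, hρ⟩ := exists_eq_ciInf_of_finite (f := fun π : Policy S A => M.policyLoss π)
  have hH : M.horizon ≤ J * epochLength M.horizon J := by
    have h1 := Nat.le_ceil ((M.horizon : ℝ) / J)
    rw [div_le_iff₀' (by exact_mod_cast hJ)] at h1
    exact_mod_cast h1
  have hlog0 : 0 ≤ Real.log (Fintype.card A) :=
    Real.log_nonneg (by exact_mod_cast Fintype.card_pos)
  have h1 := ENNReal.toReal_le_of_le_ofReal (by have := policyLoss_nonneg (M := M) ρ; positivity)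
    (mean_total_le (W := W) hD hη hH ρ)
  rw [hedgeRegret, expect_eq_toReal_mean fun c hc =>
    (reachable_run (W.len_pos hD) hc).total_nonneg, ← hρ]
  linarith

end Regret

/-! ### Tuning of the learning rate and the number of epochs -/

/-- In terms of cube roots, the unrounded number of epochs is below one. Then `T ≤ D^2`, and the
claimed bound already exceeds the trivial bound `T`. -/
theorem cube_le_of_lt_one {s a τ d : ℝ} (hs : 1 ≤ s) (ha : 1 ≤ a) (hτ : 1 ≤ τ) (hd : 1 ≤ d)
    (h : s ^ 2 * τ ^ 2 * a / d ^ 4 < 1) : τ ^ 3 ≤ a * (s ^ 2 * d ^ 2 * τ ^ 2) := by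
  rw [div_lt_one (by positivity)] at h
  have hsa : 1 ≤ s ^ 2 * a := one_le_mul_of_one_le_of_one_le (one_le_pow₀ hs) ha
  have h2 : τ ≤ d ^ 2 := by
    refine le_of_sq_le_sq ?_ (by positivity)
    calc τ ^ 2 = 1 * τ ^ 2 := (one_mul _).symm
      _ ≤ s ^ 2 * a * τ ^ 2 := by gcongr
      _ = s ^ 2 * τ ^ 2 * a := by ring
      _ ≤ (d ^ 2) ^ 2 := by rw [← pow_mul]; exact h.le
  calc τ ^ 3 = 1 * τ * τ ^ 2 := by ring
    _ ≤ s ^ 2 * a * d ^ 2 * τ ^ 2 := by gcongr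
    _ = _ := by ring

/-- The opposite degenerate case, more epochs than steps: then `T D^4 < S^2 A`, and the trivial
bound `T` again suffices. -/
theorem cube_le_of_cube_lt {s a τ d : ℝ} (hτ : 1 ≤ τ) (hd : 1 ≤ d)
    (h : τ ^ 3 < s ^ 2 * τ ^ 2 * a / d ^ 4) : τ ^ 3 ≤ a * (s ^ 2 * d ^ 2 * τ ^ 2) := by
  rw [lt_div_iff₀ (by positivity)] at h
  have h1 : τ * d ^ 4 ≤ s ^ 2 * a := by
    refine le_of_mul_le_mul_left (a := τ ^ 2) ?_ (by positivity)
    calc τ ^ 2 * (τ * d ^ 4) = τ ^ 3 * d ^ 4 := by ring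
      _ ≤ s ^ 2 * τ ^ 2 * a := h.le
      _ = _ := by ring
  calc τ ^ 3 = τ * 1 * 1 * τ ^ 2 := by ring
    _ ≤ τ * d ^ 4 * d ^ 2 * τ ^ 2 := by gcongr <;> exact one_le_pow₀ hd
    _ ≤ s ^ 2 * a * d ^ 2 * τ ^ 2 := by gcongr
    _ = _ := by ring

/-- The choice of the learning rate and of the number of epochs balances the three parts of the
regret, unless the bound is trivial. -/
theorem regret_tuning {nS nA T D : ℝ} (hS : 2 ≤ nS) (hA : 1 ≤ nA) (hT : 1 ≤ T) (hD : 1 ≤ D)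
    {R : ℝ → ℕ → ℝ} (hRT : ∀ η J, R η J ≤ T)
    (hR : ∀ η J, 0 < η → 0 < J → R η J ≤ 12 * J * D ^ 2 + nS * Real.log nA / η +
      η * ⌈T / J⌉₊ * (T * (nS * nA))) :
    R (nS ^ (1 / 3 : ℝ) / (nA ^ (1 / 3 : ℝ) * (D * T) ^ (2 / 3 : ℝ)))
        ⌈(nS * T) ^ (2 / 3 : ℝ) * nA ^ (1 / 3 : ℝ) / D ^ (4 / 3 : ℝ)⌉₊ ≤
      53 * Real.log (nS * nA * T) ^ 1 * (nA ^ (1 / 3 : ℝ) * (nS * D * T) ^ (2 / 3 : ℝ)) := by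
  -- Replacing all quantities by their cube roots turns the fractional powers into polynomial ones.
  have hroot : ∀ x : ℝ, 1 ≤ x → ∃ y : ℝ, 1 ≤ y ∧ x = y ^ 3 ∧ x ^ (1 / 3 : ℝ) = y ∧
      x ^ (2 / 3 : ℝ) = y ^ 2 ∧ x ^ (4 / 3 : ℝ) = y ^ 4 := by
    intro x hx
    have hx0 : 0 ≤ x := by linarith
    refine ⟨x ^ (1 / 3 : ℝ), Real.one_le_rpow hx (by norm_num), ?_, rfl, ?_, ?_⟩ <;>
    · rw [← Real.rpow_natCast, ← Real.rpow_mul hx0]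
      norm_num
  have hmain : 1 / 2 ≤ Real.log (nS * nA * T) := by
    have h1 : (1 : ℝ) / 2 ≤ Real.log 2 := by linarith [Real.log_two_gt_d9]
    refine h1.trans (Real.log_le_log (by norm_num) ?_)
    have : 2 * 1 ≤ nS * nA := mul_le_mul hS hA zero_le_one (by linarith)
    nlinarith
  have hlogA : Real.log nA ≤ Real.log (nS * nA * T) := by
    refine Real.log_le_log (by linarith) ?_
    have : 1 * nA ≤ nS * nA := mul_le_mul_of_nonneg_right (by linarith) (by linarith)
    nlinarith
  have hmul : ∀ p q : ℝ, 1 ≤ p → 1 ≤ q → (p * q) ^ (2 / 3 : ℝ) = p ^ (2 / 3 : ℝ) * q ^ (2 / 3 : ℝ) :=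
    fun p q hp hq => Real.mul_rpow (by linarith) (by linarith)
  rw [hmul D T hD hT, hmul nS T (by linarith) hT,
    hmul (nS * D) T (one_le_mul_of_one_le_of_one_le (by linarith) hD) hT,
    hmul nS D (by linarith) hD, pow_one]
  set ℓ := Real.log (nS * nA * T)
  set lA := Real.log nA with hlA
  obtain ⟨s, hs, es, es1, es2, -⟩ := hroot nS (by linarith)
  obtain ⟨a, ha, ea, ea1, -, -⟩ := hroot nA hA
  obtain ⟨τ, hτ, eτ, -, eτ2, -⟩ := hroot T hT
  obtain ⟨d, hd, ed, -, ed2, ed4⟩ := hroot D hD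
  rw [es1, es2, ea1, eτ2, ed2, ed4]
  set x := s ^ 2 * τ ^ 2 * a / d ^ 4 with hx
  set η := s / (a * (d ^ 2 * τ ^ 2)) with hη
  set Y := a * (s ^ 2 * d ^ 2 * τ ^ 2) with hY
  have hY0 : 0 < Y := by positivity
  have hx0 : 0 < x := by positivity
  have hη0 : 0 < η := by positivity
  have hYℓ : 1 / 2 * Y ≤ ℓ * Y := by gcongr
  have hYle : Y ≤ 53 * ℓ * Y := by linarith
  rcases lt_or_ge x 1 with hx1 | hx1
  · refine (hRT _ _).trans (le_trans ?_ hYle)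
    rw [eτ]
    exact cube_le_of_lt_one hs ha hτ hd hx1
  rcases lt_or_ge T x with hxT | hxT
  · refine (hRT _ _).trans (le_trans ?_ hYle)
    rw [eτ] at hxT ⊢
    exact cube_le_of_cube_lt hτ hd hxT
  -- Here `1 ≤ x ≤ T`, so rounding `J` and `H` up costs at most a factor `2` each.
  have hJ0 : 0 < ⌈x⌉₊ := Nat.ceil_pos.2 hx0
  have hJx : (⌈x⌉₊ : ℝ) ≤ 2 * x := by linarith [Nat.ceil_lt_add_one hx0.le]
  have hxJ : x ≤ ⌈x⌉₊ := Nat.le_ceil x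
  have hT0 : 0 ≤ T := by linarith
  have hH : (⌈T / ⌈x⌉₊⌉₊ : ℝ) ≤ 2 * (T / x) := by
    have h1 : (⌈T / ⌈x⌉₊⌉₊ : ℝ) < T / ⌈x⌉₊ + 1 := Nat.ceil_lt_add_one (by positivity)
    have h2 : T / ⌈x⌉₊ ≤ T / x := by gcongr
    have h3 : 1 ≤ T / x := (one_le_div hx0).2 hxT
    linarith
  refine (hR _ _ hη0 hJ0).trans ?_
  have b1 : 12 * ⌈x⌉₊ * D ^ 2 ≤ 24 * Y := by
    calc 12 * (⌈x⌉₊ : ℝ) * D ^ 2 ≤ 12 * (2 * x) * D ^ 2 := by gcongr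
      _ = 24 * Y := by rw [hx, hY, ed]; field_simp; norm_num
  have b2 : nS * lA / η = lA * Y := by
    rw [hη, hY, es]; field_simp
  have b3 : η * ⌈T / ⌈x⌉₊⌉₊ * (T * (nS * nA)) ≤ 2 * Y := by
    calc _ ≤ η * (2 * (T / x)) * (T * (nS * nA)) := by gcongr
      _ = 2 * Y := by rw [hη, hx, hY, es, ea, eτ]; field_simp
  rw [b2]
  have b4 : lA * Y ≤ ℓ * Y := by gcongr
  -- The three parts are at most `24 Y`, `ℓ Y` and `2 Y`; as `ℓ ≥ 1/2`, the sum is at most `(52 + 1)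
  -- ℓ Y`.
  linarith

end AMDP

end

theorem mainTheorem6 :
    ∃ (C : ℝ) (k : ℕ), ∀ (S A : Type*) [Fintype S] [DecidableEq S] [Nontrivial S]
      [Fintype A] [DecidableEq A] [Nonempty A] (M : AMDP S A) (sStar : S) (aStar : A),
      M.trans sStar aStar sStar = 1 → M.diameter < ⊤ → 1 ≤ M.horizon →
      ∀ (nS nA T D : ℝ), nS = Fintype.card S → nA = Fintype.card A → T = M.horizon →
        D = M.diameter.toReal →
      Nonempty (M.SwitchPlan sStar) ∧
      ∀ W : M.SwitchPlan sStar,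
        AMDP.hedgeRegret W
            (nS ^ (1 / 3 : ℝ) / (nA ^ (1 / 3 : ℝ) * (D * T) ^ (2 / 3 : ℝ)))
            ⌈(nS * T) ^ (2 / 3 : ℝ) * nA ^ (1 / 3 : ℝ) / D ^ (4 / 3 : ℝ)⌉₊ ≤
          C * Real.log (nS * nA * T) ^ k * (nA ^ (1 / 3 : ℝ) * (nS * D * T) ^ (2 / 3 : ℝ)) := by
  refine ⟨53, 1, ?_⟩
  intro S A _ _ _ _ _ _ M sStar aStar hstay hD hT nS nA T D rfl rfl rfl rfl
  refine ⟨M.nonempty_switchPlan hstay hD, fun W => ?_⟩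
  have hD1 : 1 ≤ M.diameter.toReal := by
    have := ENNReal.toReal_mono hD.ne M.one_le_diameter
    simpa using this
  exact AMDP.regret_tuning (R := AMDP.hedgeRegret W) (by exact_mod_cast Fintype.one_lt_card)
    (by exact_mod_cast Fintype.card_pos) (by exact_mod_cast hT) hD1
    (fun η J => AMDP.hedgeRegret_le_horizon hD J) (fun η J hη hJ => AMDP.hedgeRegret_le hD hη hJ)
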